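/- Let $M>0$ and let $\rho_1,\sigma_1\in H^2(-1,0)$, $q_1\in C([-1,0])$, $\rho_2,\sigma_2\in H^2(0,1)$, $q_2\in C([0,1])$ be real-valued functions, each bounded below by a positive constant on its interval. Consider the spectral problem, for $\nu\in\mathbb{R}$ and $(u,v)\in H^2(-1,0)\times H^2(0,1)$ not identically zero, $$\begin{cases}-(\sigma_1u')'+q_1u=\nu\rho_1u & \text{on }(-1,0),\\ -(\sigma_2v')'+q_2v=\nu\rho_2v & \text{on }(0,1),\\ u(-1)=0,\quad v'(1)=0,\quad u(0)=v(0),\\ \sigma_1(0)u'(0)-\sigma_2(0)v'(0)=\nu M\,u(0).\end{cases}$$ Its eigenvalues are simple and form an infinite sequence $0<\nu_1<\nu_2<\cdots$ tending to $+\infty$, and there is a constant $\delta_2>0$, depending only on $\rho_i,\sigma_i,q_i$ $(i=1,2)$ and $M$, such that $$\nu_{n+1}-\nu_n\ge\delta_2\qquad\text{for all } n\ge1 .$$ -/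

import Mathlib

open Set Filter Topology MeasureTheory

/-- `f` (more precisely, its restriction to `[a, b]`) is the continuous representative of an
element of the Sobolev space `H²(a, b)`: `f` is the primitive of a function `f'` which is itself
the primitive of a function `f'' ∈ L²(a, b)`.  Values of `f` outside `[a, b]` play no role. -/
def MemH2 (a b : ℝ) (f : ℝ → ℝ) : Prop :=
  ∃ f' f'' : ℝ → ℝ, MemLp f'' 2 (volume.restrict (Ioo a b)) ∧
    (∀ x ∈ Icc a b, f x = f a + ∫ t in a..x, f' t) ∧
    (∀ x ∈ Icc a b, f' x = f' a + ∫ t in a..x, f'' t)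

/-- `f` is bounded below by a positive constant on `[a, b]`. -/
def UniformlyPositiveOn (a b : ℝ) (f : ℝ → ℝ) : Prop :=
  ∃ c > 0, ∀ x ∈ Icc a b, c ≤ f x

/-- `y` belongs to `H²(a, b)` and solves `-(σ y')' + q y = ν ρ y` on `(a, b)`, as an identity of
functions in `L²(a, b)`, that is, almost everywhere.  (For `σ, y ∈ H²(a, b)` the function `y` is
continuously differentiable and `σ y'` is absolutely continuous.) -/
def SolvesSturmLiouville (a b : ℝ) (ρ σ q : ℝ → ℝ) (ν : ℝ) (y : ℝ → ℝ) : Prop :=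
  MemH2 a b y ∧
    ∀ᵐ x ∂(volume.restrict (Ioo a b)),
      -deriv (fun s => σ s * deriv y s) x + q x * y x = ν * ρ x * y x

/-- The coefficients of the two rods, occupying `[-1, 0]` and `[0, 1]`, and the mass `M > 0`
at the point `0` which connects them. -/
structure PointMassSystem where
  /-- density of the left rod -/
  ρ₁ : ℝ → ℝ
  /-- conductivity of the left rod -/
  σ₁ : ℝ → ℝ
  /-- potential on the left rod -/
  q₁ : ℝ → ℝ
  /-- density of the right rod -/
  ρ₂ : ℝ → ℝ
  /-- conductivity of the right rod -/
  σ₂ : ℝ → ℝ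
  /-- potential on the right rod -/
  q₂ : ℝ → ℝ
  /-- the point mass -/
  M : ℝ
  ρ₁_mem : MemH2 (-1) 0 ρ₁
  σ₁_mem : MemH2 (-1) 0 σ₁
  q₁_cont : ContinuousOn q₁ (Icc (-1) 0)
  ρ₂_mem : MemH2 0 1 ρ₂
  σ₂_mem : MemH2 0 1 σ₂
  q₂_cont : ContinuousOn q₂ (Icc 0 1)
  ρ₁_pos : UniformlyPositiveOn (-1) 0 ρ₁
  σ₁_pos : UniformlyPositiveOn (-1) 0 σ₁
  q₁_pos : UniformlyPositiveOn (-1) 0 q₁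
  ρ₂_pos : UniformlyPositiveOn 0 1 ρ₂
  σ₂_pos : UniformlyPositiveOn 0 1 σ₂
  q₂_pos : UniformlyPositiveOn 0 1 q₂
  M_pos : 0 < M

namespace PointMassSystem

/-- `(u, v)` is a solution (possibly zero) of the spectral problem with parameter `ν`, with a
Dirichlet condition at `-1` and a Neumann condition at `1`.  The derivatives at the endpoints
`0` and `1` of the rods are the one-sided ones. -/
structure IsNeumannSolution (S : PointMassSystem) (ν : ℝ) (u v : ℝ → ℝ) : Prop where
  left_eq : SolvesSturmLiouville (-1) 0 S.ρ₁ S.σ₁ S.q₁ ν u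
  right_eq : SolvesSturmLiouville 0 1 S.ρ₂ S.σ₂ S.q₂ ν v
  dirichlet : u (-1) = 0
  neumann : derivWithin v (Icc 0 1) 1 = 0
  continuity : u 0 = v 0
  mass : S.σ₁ 0 * derivWithin u (Icc (-1) 0) 0 - S.σ₂ 0 * derivWithin v (Icc 0 1) 0
    = ν * S.M * u 0

/-- `(u, v)` is an eigenfunction for `ν`: a solution of the spectral problem which does not
vanish identically on `[-1, 0]` and `[0, 1]`. -/
def IsNeumannEigenfunction (S : PointMassSystem) (ν : ℝ) (u v : ℝ → ℝ) : Prop :=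
  S.IsNeumannSolution ν u v ∧ ¬ ((∀ x ∈ Icc (-1) 0, u x = 0) ∧ ∀ x ∈ Icc 0 1, v x = 0)

/-- The set of eigenvalues of the spectral problem. -/
def neumannEigenvalues (S : PointMassSystem) : Set ℝ :=
  {ν | ∃ u v : ℝ → ℝ, S.IsNeumannEigenfunction ν u v}

/-- The eigenvalue `ν` is simple: there is an eigenfunction, and every solution of the spectral
problem is, on `[-1, 0]` and `[0, 1]`, a scalar multiple of it. -/
def IsSimpleNeumannEigenvalue (S : PointMassSystem) (ν : ℝ) : Prop :=
  ∃ u v : ℝ → ℝ, S.IsNeumannEigenfunction ν u v ∧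
    ∀ u' v' : ℝ → ℝ, S.IsNeumannSolution ν u' v' →
      ∃ c : ℝ, (∀ x ∈ Icc (-1) 0, u' x = c * u x) ∧ ∀ x ∈ Icc 0 1, v' x = c * v x

end PointMassSystem

/-!
Each rod is moved to `[0, 1]`, with its outer end at `0` and the mass at `1`, and its equation is
written as the first-order system `y' = p / σ`, `p' = (q - ν ρ) y` (`SLSystem`). An `H²` solution is
a classical solution of the system because the flux `σ y'` is absolutely continuous
(`SolvesSturmLiouville.exists_system`). If `(a, p)` and `(b, r)` are the values at the mass of the
solutions of the two rods which satisfy the outer boundary condition with unit data, then `ν` is an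
eigenvalue exactly when `p b + r a = ν M a b`. Positivity comes from the monotonicity of `y p` for
`ν ≤ 0`, and simplicity from uniqueness for the Cauchy problem.

The gap. The energy `(1 + ν) ρ σ y² + p²` changes along a solution at most by a factor independent
of `ν`, because the weight `ρ σ` cancels the terms of order `ν` in its derivative. Hence
(`Rod.comparison`) solutions with the same initial data and parameters `ν < μ` have end values
which differ by `O(μ - ν)` in the norm scaled by the frequency, and the Wronskian identity gives
these values a definite orientation, which expresses that `p / a` decreases in `ν`. Suppose that two
eigenvalues are very close. Since `p / a + r / b = ν M` increases with `ν`, one of the two quotients,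
say `p / a`, must pass through a pole in between. Being close to a pole on both sides, it is large
and negative for `ν` and large and positive for `μ`, of an order which exceeds `ν M`. Thus `r / b`
is large and positive for `ν` and large and negative for `μ`. This is impossible for close end
values: if `b` changed its sign, then `r / b` would jump from negative to positive values, and
otherwise `r` changes its sign, so that `r / b` is small (`CloseData.false_of_characteristic`).
The case where `a` and `b` vanish simultaneously is similar.

Existence. With the Prüfer phases `Θ₁`, `Θ₂` of the two solutions at the mass and `s = √ν`, the
characteristic equation becomes `sin (Θ₁ + Θ₂) = s M sin Θ₁ sin Θ₂`. The phases depend continuously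
on `s` and tend to infinity (`Rod.exists_polar`), and the difference of the two sides changes sign
whenever `Θ₁ + Θ₂` passes from a multiple of `π` to the next, so the eigenvalues are unbounded
(`exists_pairEigenvalue_gt`). An unbounded set of positive reals with a uniform gap is the range of
an increasing sequence.
-/

/-! ### Energy estimates for the first-order system -/

theorem hasDerivAt_of_Icc {f : ℝ → ℝ} {f' a b x : ℝ} (h : HasDerivWithinAt f f' (Icc a b) x)
    (hx : x ∈ Ioo a b) : HasDerivAt f f' x := h.hasDerivAt (Icc_mem_nhds hx.1 hx.2)

/-- The first-order form `y' = p / σ`, `p' = (q - ν ρ) y` on `[a, b]` of the Sturm-Liouville equation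
`-(σ y')' + q y = ν ρ y`, with one-sided derivatives at the endpoints. -/
def SLSystem (a b : ℝ) (ρ σ q : ℝ → ℝ) (ν : ℝ) (y p : ℝ → ℝ) : Prop :=
  ∀ x ∈ Icc a b, HasDerivWithinAt y (p x / σ x) (Icc a b) x ∧
    HasDerivWithinAt p ((q x - ν * ρ x) * y x) (Icc a b) x

/-- The coefficients of a rod occupying `[0, 1]`, together with bounds for them: `ρ` and `σ` are
differentiable with bounded derivatives `dρ` and `dσ`, and `ρ`, `σ`, `q` take values in `[c, B]`. -/
structure Rod where
  /-- density -/
  ρ : ℝ → ℝ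
  /-- conductivity -/
  σ : ℝ → ℝ
  /-- potential -/
  q : ℝ → ℝ
  /-- derivative of the density -/
  dρ : ℝ → ℝ
  /-- derivative of the conductivity -/
  dσ : ℝ → ℝ
  /-- lower bound of the coefficients -/
  c : ℝ
  /-- upper bound of the coefficients and of the derivatives -/
  B : ℝ
  c_pos : 0 < c
  hasDeriv_ρ : ∀ t ∈ Icc (0 : ℝ) 1, HasDerivWithinAt ρ (dρ t) (Icc 0 1) t
  hasDeriv_σ : ∀ t ∈ Icc (0 : ℝ) 1, HasDerivWithinAt σ (dσ t) (Icc 0 1) t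
  cont_q : ContinuousOn q (Icc 0 1)
  le_ρ : ∀ t ∈ Icc (0 : ℝ) 1, c ≤ ρ t
  le_σ : ∀ t ∈ Icc (0 : ℝ) 1, c ≤ σ t
  le_q : ∀ t ∈ Icc (0 : ℝ) 1, c ≤ q t
  ρ_le : ∀ t ∈ Icc (0 : ℝ) 1, ρ t ≤ B
  σ_le : ∀ t ∈ Icc (0 : ℝ) 1, σ t ≤ B
  q_le : ∀ t ∈ Icc (0 : ℝ) 1, q t ≤ B
  dρ_le : ∀ t ∈ Icc (0 : ℝ) 1, |dρ t| ≤ B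
  dσ_le : ∀ t ∈ Icc (0 : ℝ) 1, |dσ t| ≤ B

namespace Rod

variable (r : Rod)

/-- `(y, p)` solves the first-order system of the rod with spectral parameter `ν`. -/
def IsSol (ν : ℝ) (y p : ℝ → ℝ) : Prop := SLSystem 0 1 r.ρ r.σ r.q ν y p

theorem c_le_B : r.c ≤ r.B := (r.le_ρ 0 (by simp)).trans (r.ρ_le 0 (by simp))

theorem B_pos : 0 < r.B := r.c_pos.trans_le r.c_le_B

theorem cont_ρ : ContinuousOn r.ρ (Icc 0 1) := fun t ht => (r.hasDeriv_ρ t ht).continuousWithinAt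

theorem cont_σ : ContinuousOn r.σ (Icc 0 1) := fun t ht => (r.hasDeriv_σ t ht).continuousWithinAt

/-- The exponential rate in the energy estimate. -/
noncomputable def rate : ℝ := 2 * r.B ^ 2 / r.c ^ 2 + 2 * r.B / r.c ^ 2 + 2 * r.B + 1

/-- The energy `(1 + ν) ρ σ y² + p²`; the weight `ρ σ` removes the terms of order `ν` from its
derivative. -/
def energy (ν : ℝ) (y p : ℝ → ℝ) (t : ℝ) : ℝ :=
  (1 + ν) * (r.ρ t * r.σ t) * y t ^ 2 + p t ^ 2

/-- The derivative of the energy along a solution with forcing term `g`. -/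
def energyDeriv (ν : ℝ) (g y p : ℝ → ℝ) (t : ℝ) : ℝ :=
  (1 + ν) * (r.dρ t * r.σ t + r.ρ t * r.dσ t) * y t ^ 2 + 2 * p t * (r.ρ t + r.q t) * y t
    - 2 * p t * g t

variable {r}

theorem hasDerivWithinAt_energy {ν : ℝ} {g y p : ℝ → ℝ} {t : ℝ} (ht : t ∈ Icc (0 : ℝ) 1)
    (hy : HasDerivWithinAt y (p t / r.σ t) (Icc 0 1) t)
    (hp : HasDerivWithinAt p ((r.q t - ν * r.ρ t) * y t - g t) (Icc 0 1) t) :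
    HasDerivWithinAt (r.energy ν y p) (r.energyDeriv ν g y p t) (Icc 0 1) t := by
  have hσ : r.σ t ≠ 0 := (r.c_pos.trans_le (r.le_σ t ht)).ne'
  have h := ((((r.hasDeriv_ρ t ht).mul (r.hasDeriv_σ t ht)).const_mul (1 + ν)).mul
    (hy.pow 2)).add (hp.pow 2)
  refine h.congr_deriv ?_
  simp only [energyDeriv, Pi.mul_apply, Pi.pow_apply]
  field_simp
  ring

theorem abs_energyDeriv_le {ν : ℝ} (hν : 0 ≤ ν) (g y p : ℝ → ℝ) {t : ℝ}
    (ht : t ∈ Icc (0 : ℝ) 1) :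
    |r.energyDeriv ν g y p t| ≤ r.rate * r.energy ν y p t + g t ^ 2 := by
  have hc := r.c_pos
  have hB := r.B_pos
  have hρ := r.le_ρ t ht
  have hσ := r.le_σ t ht
  have hq := r.le_q t ht
  have hρB := r.ρ_le t ht
  have hσB := r.σ_le t ht
  have hqB := r.q_le t ht
  have hd : |r.dρ t * r.σ t + r.ρ t * r.dσ t| ≤ 2 * r.B ^ 2 := by
    have h1 : |r.dρ t * r.σ t| ≤ r.B * r.B := by
      rw [abs_mul, abs_of_pos (hc.trans_le hσ)]
      exact mul_le_mul (r.dρ_le t ht) hσB (hc.trans_le hσ).le hB.le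
    have h2 : |r.ρ t * r.dσ t| ≤ r.B * r.B := by
      rw [abs_mul, abs_of_pos (hc.trans_le hρ)]
      exact mul_le_mul hρB (r.dσ_le t ht) (abs_nonneg _) hB.le
    exact (abs_add_le _ _).trans (by linarith)
  have hcc : r.c ^ 2 ≤ r.ρ t * r.σ t := by
    rw [sq]; exact mul_le_mul hρ hσ hc.le (hc.le.trans hρ)
  have hY : (1 + ν) * y t ^ 2 * r.c ^ 2 ≤ (1 + ν) * (r.ρ t * r.σ t) * y t ^ 2 := by
    have := mul_le_mul_of_nonneg_left hcc (by positivity : 0 ≤ (1 + ν) * y t ^ 2)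
    linarith
  set Y := (1 + ν) * y t ^ 2 with hYdef
  set E := r.energy ν y p t with hE
  have hEdef : E = (1 + ν) * (r.ρ t * r.σ t) * y t ^ 2 + p t ^ 2 := rfl
  have hY0 : 0 ≤ Y := by positivity
  have hyY : y t ^ 2 ≤ Y := by
    rw [hYdef]; nlinarith [sq_nonneg (y t)]
  have hYE : Y ≤ E / r.c ^ 2 := by
    rw [le_div_iff₀ (by positivity)]; nlinarith [sq_nonneg (p t)]
  have hpE : p t ^ 2 ≤ E := by
    have : 0 ≤ Y * r.c ^ 2 := by positivity
    linarith
  have t1 : |(1 + ν) * (r.dρ t * r.σ t + r.ρ t * r.dσ t) * y t ^ 2| ≤ 2 * r.B ^ 2 * Y := by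
    rw [show (1 + ν) * (r.dρ t * r.σ t + r.ρ t * r.dσ t) * y t ^ 2
      = (r.dρ t * r.σ t + r.ρ t * r.dσ t) * Y by rw [hYdef]; ring, abs_mul, abs_of_nonneg hY0]
    exact mul_le_mul_of_nonneg_right hd hY0
  have t2 : |2 * p t * (r.ρ t + r.q t) * y t| ≤ 2 * r.B * (p t ^ 2 + Y) := by
    have h1 : |2 * (p t * y t)| ≤ p t ^ 2 + Y := by
      rw [abs_le]; constructor <;> nlinarith [sq_nonneg (p t + y t), sq_nonneg (p t - y t)]
    rw [show 2 * p t * (r.ρ t + r.q t) * y t = (r.ρ t + r.q t) * (2 * (p t * y t)) by ring,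
      abs_mul, abs_of_pos (by linarith)]
    exact mul_le_mul (by linarith) h1 (abs_nonneg _) (by linarith)
  have t3 : |2 * p t * g t| ≤ p t ^ 2 + g t ^ 2 := by
    rw [abs_le]; constructor <;> nlinarith [sq_nonneg (p t + g t), sq_nonneg (p t - g t)]
  have hsum : |r.energyDeriv ν g y p t| ≤ 2 * r.B ^ 2 * Y + 2 * r.B * (p t ^ 2 + Y)
      + (p t ^ 2 + g t ^ 2) := by
    unfold energyDeriv
    refine (abs_sub _ _).trans ?_
    exact add_le_add ((abs_add_le _ _).trans (add_le_add t1 t2)) t3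
  have k1 : 2 * r.B ^ 2 * Y ≤ 2 * r.B ^ 2 / r.c ^ 2 * E := by
    calc _ ≤ 2 * r.B ^ 2 * (E / r.c ^ 2) := by gcongr
      _ = _ := by ring
  have k2 : 2 * r.B * Y ≤ 2 * r.B / r.c ^ 2 * E := by
    calc _ ≤ 2 * r.B * (E / r.c ^ 2) := by gcongr
      _ = _ := by ring
  have k3 : 2 * r.B * p t ^ 2 ≤ 2 * r.B * E := by gcongr
  have : r.rate * E = 2 * r.B ^ 2 / r.c ^ 2 * E + 2 * r.B / r.c ^ 2 * E + 2 * r.B * E + E := by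
    unfold rate; ring
  linarith

theorem rate_nonneg : 0 ≤ r.rate := by
  have := r.B_pos
  unfold rate; positivity

/-- Forward Grönwall estimate for the energy of a forced solution. -/
theorem energy_le_of_forced {ν : ℝ} (hν : 0 ≤ ν) {g y p : ℝ → ℝ} (hg : ContinuousOn g (Icc 0 1))
    (hy : ∀ t ∈ Icc (0 : ℝ) 1, HasDerivWithinAt y (p t / r.σ t) (Icc 0 1) t)
    (hp : ∀ t ∈ Icc (0 : ℝ) 1,
      HasDerivWithinAt p ((r.q t - ν * r.ρ t) * y t - g t) (Icc 0 1) t)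
    {t : ℝ} (ht : t ∈ Icc (0 : ℝ) 1) :
    r.energy ν y p t ≤ Real.exp r.rate * (r.energy ν y p 0 + ∫ x in (0 : ℝ)..1, g x ^ 2) := by
  have hE : ∀ t ∈ Icc (0 : ℝ) 1, HasDerivWithinAt (r.energy ν y p)
      (r.energyDeriv ν g y p t) (Icc 0 1) t :=
    fun t ht => hasDerivWithinAt_energy ht (hy t ht) (hp t ht)
  have hg2 : ContinuousOn (fun x => g x ^ 2) (Icc 0 1) := hg.pow 2
  have hint : ∀ a ∈ Icc (0 : ℝ) 1, ∀ b ∈ Icc (0 : ℝ) 1,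
      IntervalIntegrable (fun x => g x ^ 2) volume a b := fun a ha b hb =>
    (hg2.mono (uIcc_subset_Icc ha hb)).intervalIntegrable
  have hG : ∀ t ∈ Ioo (0 : ℝ) 1, HasDerivAt (fun t => ∫ x in (0 : ℝ)..t, g x ^ 2) (g t ^ 2) t := by
    intro t ht
    refine intervalIntegral.integral_hasDerivAt_right
      (hint 0 (by simp) t (Ioo_subset_Icc_self ht)) ?_ ?_
    · exact (hg2.mono Ioo_subset_Icc_self).stronglyMeasurableAtFilter isOpen_Ioo t ht
    · exact hg2.continuousAt (Icc_mem_nhds ht.1 ht.2)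
  have hGc : ContinuousOn (fun t => ∫ x in (0 : ℝ)..t, g x ^ 2) (Icc 0 1) := by
    have := intervalIntegral.continuousOn_primitive_interval (μ := volume)
      (f := fun x => g x ^ 2) (a := 0) (b := 1) (by
        rw [uIcc_of_le zero_le_one]; exact hg2.integrableOn_Icc)
    rwa [uIcc_of_le zero_le_one] at this
  have hEc : ContinuousOn (r.energy ν y p) (Icc 0 1) := fun t ht => (hE t ht).continuousWithinAt
  have hanti : AntitoneOn (fun t => r.energy ν y p t * Real.exp (-(r.rate * t))
      - ∫ x in (0 : ℝ)..t, g x ^ 2) (Icc 0 1) := by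
    refine antitoneOn_of_hasDerivWithinAt_nonpos (convex_Icc 0 1)
      (f' := fun t => r.energyDeriv ν g y p t * Real.exp (-(r.rate * t))
        + r.energy ν y p t * (Real.exp (-(r.rate * t)) * -(r.rate * 1)) - g t ^ 2) ?_ ?_ ?_
    · exact (hEc.mul (by fun_prop)).sub hGc
    · intro x hx
      rw [interior_Icc] at hx ⊢
      have h1 := hasDerivAt_of_Icc (hE x (Ioo_subset_Icc_self hx)) hx
      have h2 : HasDerivAt (fun t => Real.exp (-(r.rate * t)))
          (Real.exp (-(r.rate * x)) * -(r.rate * 1)) x :=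
        (((hasDerivAt_id x).const_mul r.rate).neg).exp
      exact ((h1.mul h2).sub (hG x hx)).hasDerivWithinAt
    · intro x hx
      rw [interior_Icc] at hx
      have h1 := (abs_le.1 (abs_energyDeriv_le (r := r) hν g y p (Ioo_subset_Icc_self hx))).2
      have h2 : Real.exp (-(r.rate * x)) ≤ 1 := by
        rw [Real.exp_le_one_iff]
        nlinarith [rate_nonneg (r := r), hx.1]
      have h3 := Real.exp_pos (-(r.rate * x))
      nlinarith [sq_nonneg (g x), mul_le_mul_of_nonneg_right h1 h3.le]
  have h := hanti (by simp : (0 : ℝ) ∈ Icc (0 : ℝ) 1) ht ht.1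
  simp only [intervalIntegral.integral_same, mul_zero, neg_zero, Real.exp_zero, mul_one,
    sub_zero] at h
  have hle : ∫ x in (0 : ℝ)..t, g x ^ 2 ≤ ∫ x in (0 : ℝ)..1, g x ^ 2 := by
    rw [← intervalIntegral.integral_add_adjacent_intervals (hint 0 (by simp) t ht)
      (hint t ht 1 (by simp))]
    have := intervalIntegral.integral_nonneg (μ := volume) ht.2 (f := fun x => g x ^ 2)
      (fun u _ => sq_nonneg _)
    linarith
  have h4 : r.energy ν y p t * Real.exp (-(r.rate * t))
      ≤ r.energy ν y p 0 + ∫ x in (0 : ℝ)..1, g x ^ 2 := by linarith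
  have h5 : r.energy ν y p t = Real.exp (r.rate * t) *
      (r.energy ν y p t * Real.exp (-(r.rate * t))) := by
    rw [mul_comm, mul_assoc, ← Real.exp_add]; simp
  have hE0 : 0 ≤ r.energy ν y p 0 := by
    have := r.c_pos.trans_le (r.le_ρ 0 (by simp))
    have := r.c_pos.trans_le (r.le_σ 0 (by simp))
    unfold energy; positivity
  have hI0 : 0 ≤ ∫ x in (0 : ℝ)..1, g x ^ 2 :=
    intervalIntegral.integral_nonneg zero_le_one (fun u _ => sq_nonneg _)
  rw [h5]
  refine mul_le_mul ?_ h4 ?_ (Real.exp_pos _).le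
  · rw [Real.exp_le_exp]; nlinarith [rate_nonneg (r := r), ht.2]
  · have := r.c_pos.trans_le (r.le_ρ t ht)
    have := r.c_pos.trans_le (r.le_σ t ht)
    unfold energy; positivity

/-- Backward Grönwall estimate for the energy of a solution. -/
theorem energy_le_of_sol {ν : ℝ} (hν : 0 ≤ ν) {y p : ℝ → ℝ} (h : r.IsSol ν y p)
    {t : ℝ} (ht : t ∈ Icc (0 : ℝ) 1) :
    r.energy ν y p t ≤ Real.exp r.rate * r.energy ν y p 1 := by
  have hE : ∀ t ∈ Icc (0 : ℝ) 1, HasDerivWithinAt (r.energy ν y p)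
      (r.energyDeriv ν (fun _ => 0) y p t) (Icc 0 1) t :=
    fun t ht => hasDerivWithinAt_energy ht (h t ht).1 (by simpa using (h t ht).2)
  have hEc : ContinuousOn (r.energy ν y p) (Icc 0 1) := fun t ht => (hE t ht).continuousWithinAt
  have hmono : MonotoneOn (fun t => r.energy ν y p t * Real.exp (r.rate * t)) (Icc 0 1) := by
    refine monotoneOn_of_hasDerivWithinAt_nonneg (convex_Icc 0 1)
      (f' := fun t => r.energyDeriv ν (fun _ => 0) y p t * Real.exp (r.rate * t)
        + r.energy ν y p t * (Real.exp (r.rate * t) * (r.rate * 1))) ?_ ?_ ?_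
    · exact hEc.mul (by fun_prop)
    · intro x hx
      rw [interior_Icc] at hx ⊢
      have h1 := hasDerivAt_of_Icc (hE x (Ioo_subset_Icc_self hx)) hx
      have h2 : HasDerivAt (fun t => Real.exp (r.rate * t))
          (Real.exp (r.rate * x) * (r.rate * 1)) x :=
        ((hasDerivAt_id x).const_mul r.rate).exp
      exact (h1.mul h2).hasDerivWithinAt
    · intro x hx
      rw [interior_Icc] at hx
      have h1 := (abs_le.1 (abs_energyDeriv_le (r := r) hν (fun _ => 0) y p
        (Ioo_subset_Icc_self hx))).1
      have h3 := Real.exp_pos (r.rate * x)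
      nlinarith [mul_le_mul_of_nonneg_right h1 h3.le]
  have h := hmono ht (by simp : (1 : ℝ) ∈ Icc (0 : ℝ) 1) ht.2
  simp only [mul_one] at h
  have hE0 : 0 ≤ r.energy ν y p t := by
    have := r.c_pos.trans_le (r.le_ρ t ht)
    have := r.c_pos.trans_le (r.le_σ t ht)
    unfold energy; positivity
  have h1 : 1 ≤ Real.exp (r.rate * t) := by
    rw [Real.one_le_exp_iff]; exact mul_nonneg rate_nonneg ht.1
  nlinarith

end Rod

/-! ### Comparison of solutions with nearby parameters -/

namespace SLSystem

variable {a b ν : ℝ} {ρ σ q y p : ℝ → ℝ}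

theorem continuousOn (h : SLSystem a b ρ σ q ν y p) :
    ContinuousOn y (Icc a b) ∧ ContinuousOn p (Icc a b) :=
  ⟨fun t ht => (h t ht).1.continuousWithinAt, fun t ht => (h t ht).2.continuousWithinAt⟩

theorem sub_smul {y₂ p₂ : ℝ → ℝ} (h : SLSystem a b ρ σ q ν y p)
    (h₂ : SLSystem a b ρ σ q ν y₂ p₂) (k : ℝ) :
    SLSystem a b ρ σ q ν (fun x => y x - k * y₂ x) (fun x => p x - k * p₂ x) := by
  intro x hx
  refine ⟨((h x hx).1.sub ((h₂ x hx).1.const_mul k)).congr_deriv (by ring),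
    ((h x hx).2.sub ((h₂ x hx).2.const_mul k)).congr_deriv (by ring)⟩

theorem smul (h : SLSystem a b ρ σ q ν y p) (k : ℝ) :
    SLSystem a b ρ σ q ν (fun x => k * y x) (fun x => k * p x) := by
  intro x hx
  refine ⟨((h x hx).1.const_mul k).congr_deriv (by ring),
    ((h x hx).2.const_mul k).congr_deriv (by ring)⟩

/-- If the displacement vanishes identically, so does the flux. -/
theorem flux_eq_zero (hab : a < b) (hσ : ∀ x ∈ Icc a b, σ x ≠ 0)
    (h : SLSystem a b ρ σ q ν y p) (hy : ∀ x ∈ Icc a b, y x = 0) : ∀ x ∈ Icc a b, p x = 0 := by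
  intro x hx
  have h0 : HasDerivWithinAt y 0 (Icc a b) x :=
    (hasDerivWithinAt_const x (Icc a b) (0 : ℝ)).congr hy (hy x hx)
  have := (uniqueDiffOn_Icc hab x hx).eq_deriv _ (h x hx).1 h0
  exact (div_eq_zero_iff.1 this).resolve_right (hσ x hx)

end SLSystem

namespace Rod

variable {r : Rod}

theorem σ_ne_zero : ∀ t ∈ Icc (0 : ℝ) 1, r.σ t ≠ 0 :=
  fun t ht => (r.c_pos.trans_le (r.le_σ t ht)).ne'

theorem le_energy {ν : ℝ} (hν : 0 ≤ ν) (y p : ℝ → ℝ) {t : ℝ} (ht : t ∈ Icc (0 : ℝ) 1) :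
    r.c ^ 2 * ((1 + ν) * y t ^ 2) + p t ^ 2 ≤ r.energy ν y p t := by
  have hcc : r.c ^ 2 ≤ r.ρ t * r.σ t := by
    rw [sq]; exact mul_le_mul (r.le_ρ t ht) (r.le_σ t ht) r.c_pos.le (r.c_pos.le.trans (r.le_ρ t ht))
  have := mul_le_mul_of_nonneg_left hcc (by positivity : 0 ≤ (1 + ν) * y t ^ 2)
  unfold energy
  linarith

theorem energy_le {ν : ℝ} (hν : 0 ≤ ν) (y p : ℝ → ℝ) {t : ℝ} (ht : t ∈ Icc (0 : ℝ) 1) :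
    r.energy ν y p t ≤ (1 + r.B ^ 2) * ((1 + ν) * y t ^ 2 + p t ^ 2) := by
  have hcc : r.ρ t * r.σ t ≤ r.B ^ 2 := by
    rw [sq]
    exact mul_le_mul (r.ρ_le t ht) (r.σ_le t ht) (r.c_pos.le.trans (r.le_σ t ht)) r.B_pos.le
  have := mul_le_mul_of_nonneg_left hcc (by positivity : 0 ≤ (1 + ν) * y t ^ 2)
  have h2 : 0 ≤ (1 + ν) * y t ^ 2 := by positivity
  have h3 : 0 ≤ r.B ^ 2 * p t ^ 2 := by positivity
  unfold energy
  linarith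

/-- A solution whose Cauchy data vanish at the endpoint `1` vanishes identically. -/
theorem IsSol.eq_zero_of_right {ν : ℝ} (hν : 0 ≤ ν) {y p : ℝ → ℝ} (h : r.IsSol ν y p)
    (hy : y 1 = 0) (hp : p 1 = 0) : ∀ t ∈ Icc (0 : ℝ) 1, y t = 0 ∧ p t = 0 := by
  intro t ht
  have h1 := energy_le_of_sol hν h ht
  have h2 := le_energy (r := r) hν y p ht
  have h3 : r.energy ν y p 1 = 0 := by simp [energy, hy, hp]
  rw [h3, mul_zero] at h1
  have hc := r.c_pos
  have h4 : 0 ≤ r.c ^ 2 * ((1 + ν) * y t ^ 2) := by positivity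
  have h5 : p t ^ 2 = 0 := le_antisymm (by linarith) (sq_nonneg _)
  have h6 : r.c ^ 2 * ((1 + ν) * y t ^ 2) = 0 := le_antisymm (by linarith [sq_nonneg (p t)]) h4
  have h7 : r.c ^ 2 ≠ 0 := by positivity
  have h8 : 1 + ν ≠ 0 := by positivity
  refine ⟨?_, by simpa using h5⟩
  simpa [h7, h8] using h6

/-- A solution whose Cauchy data vanish at the endpoint `0` vanishes identically. -/
theorem IsSol.eq_zero_of_left {ν : ℝ} (hν : 0 ≤ ν) {y p : ℝ → ℝ} (h : r.IsSol ν y p)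
    (hy : y 0 = 0) (hp : p 0 = 0) : ∀ t ∈ Icc (0 : ℝ) 1, y t = 0 ∧ p t = 0 := by
  refine h.eq_zero_of_right hν ?_ ?_
  all_goals
    have h1 := energy_le_of_forced (r := r) hν (g := fun _ => 0) (by fun_prop)
      (fun t ht => (h t ht).1) (fun t ht => by simpa using (h t ht).2)
      (by simp : (1 : ℝ) ∈ Icc (0 : ℝ) 1)
    have h2 := le_energy (r := r) hν y p (by simp : (1 : ℝ) ∈ Icc (0 : ℝ) 1)
    have h3 : r.energy ν y p 0 = 0 := by simp [energy, hy, hp]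
    simp only [h3, ne_eq, OfNat.ofNat_ne_zero, not_false_eq_true, zero_pow,
      intervalIntegral.integral_zero, add_zero, mul_zero] at h1
    have hc := r.c_pos
    have h4 : 0 ≤ r.c ^ 2 * ((1 + ν) * y 1 ^ 2) := by positivity
    have h5 : p 1 ^ 2 = 0 := le_antisymm (by linarith) (sq_nonneg _)
    have h6 : r.c ^ 2 * ((1 + ν) * y 1 ^ 2) = 0 :=
      le_antisymm (by linarith [sq_nonneg (p 1)]) h4
    have h7 : r.c ^ 2 ≠ 0 := by positivity
    have h8 : 1 + ν ≠ 0 := by positivity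
  · simpa [h7, h8] using h6
  · simpa using h5

/-- The constant in `Rod.comparison`. -/
noncomputable def compConst (r : Rod) : ℝ :=
  (1 + 1 / r.c ^ 2) * (Real.exp r.rate * r.B ^ 2 *
    (Real.exp r.rate * (1 + r.B ^ 2) / r.c ^ 2)) + 2 * (Real.exp r.rate * r.B ^ 2 / r.c ^ 2)

theorem compConst_pos : 0 < r.compConst := by
  have := r.c_pos
  have := r.B_pos
  unfold compConst; positivity

/-- Comparison of two solutions with the same Cauchy data at `0` and nearby parameters `ν < μ`.
At `1` the first pair of Cauchy data is close to the second one, relative to its size and with the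
scaling that high frequencies require, and it lies strictly on one side of it. -/
theorem comparison {ν μ : ℝ} (hν : 0 ≤ ν) (hνμ : ν < μ) (hδ : r.compConst * (μ - ν) ^ 2 ≤ 1)
    {y p y' p' : ℝ → ℝ} (h : r.IsSol ν y p) (h' : r.IsSol μ y' p') (hy : y' 0 = y 0)
    (hp : p' 0 = p 0) (hne : ∃ t ∈ Icc (0 : ℝ) 1, y' t ≠ 0) :
    (1 + ν) * (y' 1 - y 1) ^ 2 + (p' 1 - p 1) ^ 2
      ≤ r.compConst * (μ - ν) ^ 2 * (y' 1 ^ 2 + p' 1 ^ 2 / (1 + μ)) ∧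
    0 < y' 1 * p 1 - y 1 * p' 1 := by
  have hc := r.c_pos
  have hB := r.B_pos
  have hμ : 0 ≤ μ := hν.trans hνμ.le
  have h1mem : (1 : ℝ) ∈ Icc (0 : ℝ) 1 := by simp
  obtain ⟨cy, -⟩ := h.continuousOn
  obtain ⟨cy', -⟩ := h'.continuousOn
  set D := μ - ν with hD
  have hDpos : 0 < D := sub_pos.2 hνμ
  -- the difference solves the equation with parameter `ν` and forcing `(μ - ν) ρ y'`
  set g : ℝ → ℝ := fun t => D * (r.ρ t * y' t) with hg
  have cg : ContinuousOn g (Icc 0 1) := continuousOn_const.mul (r.cont_ρ.mul cy')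
  have cN : ContinuousOn (fun t => r.ρ t * y' t ^ 2) (Icc 0 1) := r.cont_ρ.mul (cy'.pow 2)
  have cd2 : ContinuousOn (fun t => r.ρ t * (y' t - y t) ^ 2) (Icc 0 1) :=
    r.cont_ρ.mul ((cy'.sub cy).pow 2)
  have ii : ∀ {f : ℝ → ℝ}, ContinuousOn f (Icc 0 1) → IntervalIntegrable f volume 0 1 :=
    fun hf => ContinuousOn.intervalIntegrable (by rwa [uIcc_of_le zero_le_one])
  set N := ∫ t in (0 : ℝ)..1, r.ρ t * y' t ^ 2 with hN
  have hρpos : ∀ t ∈ Icc (0 : ℝ) 1, 0 < r.ρ t := fun t ht => hc.trans_le (r.le_ρ t ht)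
  have hNpos : 0 < N := by
    obtain ⟨t, ht, hyt⟩ := hne
    refine intervalIntegral.integral_pos zero_lt_one cN ?_ ⟨t, ht, ?_⟩
    · intro x hx
      exact mul_nonneg (hρpos x (Ioc_subset_Icc_self hx)).le (sq_nonneg _)
    · have := hρpos t ht
      positivity
  have hgint : ∫ t in (0 : ℝ)..1, g t ^ 2 ≤ D ^ 2 * r.B * N := by
    rw [hN, ← intervalIntegral.integral_const_mul]
    refine intervalIntegral.integral_mono_on zero_le_one (ii (cg.pow 2))
      (ii (continuousOn_const.mul cN)) ?_
    intro t ht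
    have h1 : r.ρ t * (r.ρ t * y' t ^ 2) ≤ r.B * (r.ρ t * y' t ^ 2) :=
      mul_le_mul_of_nonneg_right (r.ρ_le t ht) (mul_nonneg (hρpos t ht).le (sq_nonneg _))
    have h2 := mul_le_mul_of_nonneg_left h1 (sq_nonneg D)
    simp only [hg]
    linarith
  have hforced : ∀ t ∈ Icc (0 : ℝ) 1, r.c ^ 2 * ((1 + ν) * (y' t - y t) ^ 2) + (p' t - p t) ^ 2
      ≤ Real.exp r.rate * (D ^ 2 * r.B * N) := by
    intro t ht
    have e1 := energy_le_of_forced (r := r) hν (g := g) (y := fun t => y' t - y t)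
      (p := fun t => p' t - p t) cg
      (fun t ht => ((h' t ht).1.sub (h t ht).1).congr_deriv (by ring))
      (fun t ht => ((h' t ht).2.sub (h t ht).2).congr_deriv (by simp only [hg, hD]; ring)) ht
    have e2 := le_energy (r := r) hν (fun t => y' t - y t) (fun t => p' t - p t) ht
    have e3 : r.energy ν (fun t => y' t - y t) (fun t => p' t - p t) 0 = 0 := by
      simp [energy, hy, hp]
    rw [e3, zero_add] at e1
    exact e2.trans (e1.trans (mul_le_mul_of_nonneg_left hgint (Real.exp_pos _).le))
  -- the size of `y'` is controlled by its Cauchy data at `1`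
  set E := y' 1 ^ 2 + p' 1 ^ 2 / (1 + μ) with hE
  have hsize : ∀ t ∈ Icc (0 : ℝ) 1,
      y' t ^ 2 ≤ Real.exp r.rate * (1 + r.B ^ 2) / r.c ^ 2 * E := by
    intro t ht
    have e1 := energy_le_of_sol hμ h' ht
    have e2 := le_energy (r := r) hμ y' p' ht
    have e3 := energy_le (r := r) hμ y' p' h1mem
    have e4 : (1 + μ) * y' 1 ^ 2 + p' 1 ^ 2 = (1 + μ) * E := by
      rw [hE]; field_simp
    rw [e4] at e3
    have e5 : r.c ^ 2 * ((1 + μ) * y' t ^ 2)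
        ≤ Real.exp r.rate * ((1 + r.B ^ 2) * ((1 + μ) * E)) := by
      have := mul_le_mul_of_nonneg_left e3 (Real.exp_pos r.rate).le
      nlinarith [sq_nonneg (p' t)]
    have e6 : (1 + μ) * (r.c ^ 2 * y' t ^ 2)
        ≤ (1 + μ) * (Real.exp r.rate * (1 + r.B ^ 2) * E) := by linarith
    have e7 := le_of_mul_le_mul_left e6 (by linarith)
    rw [div_mul_eq_mul_div, le_div_iff₀ (by positivity)]
    linarith
  have hNE : N ≤ r.B * (Real.exp r.rate * (1 + r.B ^ 2) / r.c ^ 2 * E) := by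
    have e1 : N ≤ ∫ t in (0 : ℝ)..1, r.B * (Real.exp r.rate * (1 + r.B ^ 2) / r.c ^ 2 * E) := by
      refine intervalIntegral.integral_mono_on zero_le_one (ii cN) (by simp) ?_
      intro t ht
      exact mul_le_mul (r.ρ_le t ht) (hsize t ht) (sq_nonneg _) hB.le
    simpa using e1
  have hE0 : 0 ≤ E := by
    have : 0 < 1 + μ := by linarith
    positivity
  have hexp := Real.exp_pos r.rate
  constructor
  · have e1 := hforced 1 h1mem
    set X := (1 + ν) * (y' 1 - y 1) ^ 2 with hX
    have hX0 : 0 ≤ X := by positivity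
    have e2 : X + (p' 1 - p 1) ^ 2 ≤ (1 + 1 / r.c ^ 2) * (r.c ^ 2 * X + (p' 1 - p 1) ^ 2) := by
      have : (1 + 1 / r.c ^ 2) * (r.c ^ 2 * X + (p' 1 - p 1) ^ 2)
          = X + (p' 1 - p 1) ^ 2 + (r.c ^ 2 * X + 1 / r.c ^ 2 * (p' 1 - p 1) ^ 2) := by
        field_simp; ring
      rw [this]
      have : 0 ≤ r.c ^ 2 * X + 1 / r.c ^ 2 * (p' 1 - p 1) ^ 2 := by positivity
      linarith
    have e3 : Real.exp r.rate * (D ^ 2 * r.B * N) ≤ Real.exp r.rate * (D ^ 2 * r.B *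
        (r.B * (Real.exp r.rate * (1 + r.B ^ 2) / r.c ^ 2 * E))) := by gcongr
    have e4 : (1 + 1 / r.c ^ 2) * (r.c ^ 2 * X + (p' 1 - p 1) ^ 2) ≤ (1 + 1 / r.c ^ 2) *
        (Real.exp r.rate * (D ^ 2 * r.B *
        (r.B * (Real.exp r.rate * (1 + r.B ^ 2) / r.c ^ 2 * E)))) := by
      gcongr; exact e1.trans e3
    have e5 : r.compConst * D ^ 2 * E = (1 + 1 / r.c ^ 2) *
        (Real.exp r.rate * (D ^ 2 * r.B *
        (r.B * (Real.exp r.rate * (1 + r.B ^ 2) / r.c ^ 2 * E))))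
        + 2 * (Real.exp r.rate * r.B ^ 2 / r.c ^ 2) * D ^ 2 * E := by
      unfold compConst; ring
    have e6 : 0 ≤ 2 * (Real.exp r.rate * r.B ^ 2 / r.c ^ 2) * D ^ 2 * E := by positivity
    linarith
  · -- the Wronskian has derivative `(μ - ν) ρ y y'`, whose integral is positive
    have hd2 : ∫ t in (0 : ℝ)..1, r.ρ t * (y' t - y t) ^ 2 ≤ N / 2 := by
      have e1 : ∀ t ∈ Icc (0 : ℝ) 1, r.ρ t * (y' t - y t) ^ 2
          ≤ r.B * (Real.exp r.rate * (D ^ 2 * r.B * N) / r.c ^ 2) := by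
        intro t ht
        refine mul_le_mul (r.ρ_le t ht) ?_ (sq_nonneg _) hB.le
        rw [le_div_iff₀ (by positivity)]
        have := hforced t ht
        have h3 : 0 ≤ r.c ^ 2 * (ν * (y' t - y t) ^ 2) := by positivity
        nlinarith [sq_nonneg (p' t - p t)]
      have e2 : ∫ t in (0 : ℝ)..1, r.ρ t * (y' t - y t) ^ 2
          ≤ r.B * (Real.exp r.rate * (D ^ 2 * r.B * N) / r.c ^ 2) := by
        have := intervalIntegral.integral_mono_on zero_le_one (ii cd2) (by simp) e1
        simpa using this
      have e3 : 2 * (Real.exp r.rate * r.B ^ 2 / r.c ^ 2) * D ^ 2 ≤ 1 := by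
        refine le_trans ?_ hδ
        have : 0 ≤ (1 + 1 / r.c ^ 2) * (Real.exp r.rate * r.B ^ 2 *
          (Real.exp r.rate * (1 + r.B ^ 2) / r.c ^ 2)) * D ^ 2 := by positivity
        unfold compConst
        linarith
      have e4 := mul_le_mul_of_nonneg_right e3 hNpos.le
      have e5 : r.B * (Real.exp r.rate * (D ^ 2 * r.B * N) / r.c ^ 2)
        = 2 * (Real.exp r.rate * r.B ^ 2 / r.c ^ 2) * D ^ 2 * N / 2 := by ring
      linarith
    have hW : ∀ t ∈ Icc (0 : ℝ) 1, HasDerivWithinAt (fun t => y' t * p t - y t * p' t)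
        (D * (r.ρ t * (y' t * y t))) (Icc 0 1) t := by
      intro t ht
      refine (((h' t ht).1.mul (h t ht).2).sub ((h t ht).1.mul (h' t ht).2)).congr_deriv ?_
      simp only [hD]; ring
    have cW : ContinuousOn (fun t => D * (r.ρ t * (y' t * y t))) (Icc 0 1) :=
      continuousOn_const.mul (r.cont_ρ.mul (cy'.mul cy))
    have hFTC := intervalIntegral.integral_eq_sub_of_hasDerivAt_of_le zero_le_one
      (fun t ht => (hW t ht).continuousWithinAt)
      (fun t ht => hasDerivAt_of_Icc (hW t (Ioo_subset_Icc_self ht)) ht) (ii cW)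
    simp only [hy, hp, mul_comm (y 0), sub_self, sub_zero] at hFTC
    rw [← hFTC, intervalIntegral.integral_const_mul]
    refine mul_pos hDpos ?_
    have hlow : ∫ t in (0 : ℝ)..1, (r.ρ t * y' t ^ 2 * (1 / 2)
        - r.ρ t * (y' t - y t) ^ 2 * (1 / 2)) ≤ ∫ t in (0 : ℝ)..1, r.ρ t * (y' t * y t) := by
      refine intervalIntegral.integral_mono_on zero_le_one
        (ii ((cN.mul continuousOn_const).sub (cd2.mul continuousOn_const)))
        (ii (r.cont_ρ.mul (cy'.mul cy))) ?_
      intro t ht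
      nlinarith [mul_nonneg (hρpos t ht).le (sq_nonneg (y t))]
    have i1 : IntervalIntegrable (fun t => r.ρ t * y' t ^ 2 * (1 / 2)) volume 0 1 :=
      ii (cN.mul continuousOn_const)
    have i2 : IntervalIntegrable (fun t => r.ρ t * (y' t - y t) ^ 2 * (1 / 2)) volume 0 1 :=
      ii (cd2.mul continuousOn_const)
    rw [intervalIntegral.integral_sub i1 i2, intervalIntegral.integral_mul_const,
      intervalIntegral.integral_mul_const] at hlow
    linarith

end Rod

/-! ### The characteristic equation for close Cauchy data -/

/-- Comparison of two vectors of Cauchy data `(a, p)` and `(a', p')` belonging to the spectral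
parameters `l - 1` and `l' - 1`: they are `η`-close in the scaled norm, and they are positively
oriented. -/
structure CloseData (l l' η a p a' p' : ℝ) : Prop where
  close : l * (a' - a) ^ 2 + (p' - p) ^ 2 ≤ η ^ 2 * (a' ^ 2 + p' ^ 2 / l')
  pos : 0 < a' * p - a * p'

namespace CloseData

variable {l l' η a p a' p' : ℝ}

/-- If the displacement changes sign, then both vectors are almost vertical, and the quotient
`p / a` jumps from a large negative to a large positive value (possibly through infinity). -/
theorem of_mul_nonpos (h : CloseData l l' η a p a' p') (hl : 1 ≤ l) (hll : l ≤ l')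
    (hη : 0 < η) (hη4 : η ≤ 1 / 4) (haa : a * a' ≤ 0) :
    l * a ^ 2 ≤ 2 * η * -(a * p) ∧ l * a' ^ 2 ≤ 2 * η * (a' * p') := by
  obtain ⟨hc, hD⟩ := h
  have hl' : 0 < l' := by linarith
  set e := a' ^ 2 + p' ^ 2 / l' with he
  have hP : p' ^ 2 = l' * (e - a' ^ 2) := by rw [he]; field_simp; ring
  have he0 : 0 ≤ e := by positivity
  have hη2 : η ^ 2 ≤ 1 / 16 := by nlinarith
  have ha1 : l * a ^ 2 ≤ η ^ 2 * e := by nlinarith [sq_nonneg (p' - p), sq_nonneg a']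
  have ha2 : l * a' ^ 2 ≤ η ^ 2 * e := by nlinarith [sq_nonneg (p' - p), sq_nonneg a]
  have hpd : (p' - p) ^ 2 ≤ η ^ 2 * e := by nlinarith [sq_nonneg (a' - a)]
  have hηe : η ^ 2 * e ≤ e / 16 := by nlinarith
  have hle : l * e ≤ l' * e := mul_le_mul_of_nonneg_right hll he0
  have hee : e ≤ l * e := by nlinarith
  have hsmall : a' ^ 2 ≤ e / 16 := by nlinarith [sq_nonneg a']
  have hP1 : l' * (e * (15 / 16)) ≤ p' ^ 2 := by rw [hP]; gcongr; linarith
  have hepos : 0 < e := by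
    rcases he0.lt_or_eq with h0 | h0
    · exact h0
    · have h2 : a' = 0 := by
        have : a' ^ 2 = 0 := le_antisymm (by linarith) (sq_nonneg _)
        simpa using this
      have h1 : a = 0 := by
        have h3 : a ^ 2 ≤ l * a ^ 2 := le_mul_of_one_le_left (sq_nonneg _) hl
        have : a ^ 2 = 0 := le_antisymm (by linarith) (sq_nonneg _)
        simpa using this
      simp [h1, h2] at hD
  have hpd2 : (p' - p) ^ 2 ≤ p' ^ 2 / 15 := by linarith
  have hpp : p' ^ 2 ≤ 2 * p ^ 2 := by linarith [sq_nonneg (2 * p' - 3 * p), sq_nonneg p']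
  have hpp0 : 0 < p' * p := by linarith [sq_nonneg p]
  have key : ∀ x z : ℝ, l * x ^ 2 ≤ η ^ 2 * e → l * e ≤ 4 * z ^ 2 → l * |x| ≤ 2 * η * |z| := by
    intro x z hx hz
    have h1 : (l * |x|) ^ 2 ≤ (2 * η * |z|) ^ 2 := by
      rw [mul_pow, mul_pow, mul_pow, sq_abs, sq_abs]
      have h2 : l * (l * x ^ 2) ≤ l * (η ^ 2 * e) := by gcongr
      have h3 : η ^ 2 * (l * e) ≤ η ^ 2 * (4 * z ^ 2) := by gcongr
      linarith
    exact abs_le_of_sq_le_sq' h1 (by positivity) |>.2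
  have hz' : l * e ≤ 4 * p' ^ 2 := by linarith
  have hz : l * e ≤ 4 * p ^ 2 := by linarith
  suffices hs : a * p ≤ 0 ∧ 0 ≤ a' * p' by
    have k1 := mul_le_mul_of_nonneg_right (key a p ha1 hz) (abs_nonneg a)
    have k2 := mul_le_mul_of_nonneg_right (key a' p' ha2 hz') (abs_nonneg a')
    rw [mul_assoc, abs_mul_abs_self, mul_assoc, ← abs_mul] at k1 k2
    rw [mul_comm p, abs_of_nonpos hs.1] at k1
    rw [mul_comm p', abs_of_nonneg hs.2] at k2
    exact ⟨by linarith, by linarith⟩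
  refine ⟨?_, ?_⟩
  · by_contra! hneg
    have h1 : 0 < a * p' := by
      have : 0 < (a * p') * p ^ 2 := by
        calc 0 < (a * p) * (p' * p) := mul_pos hneg hpp0
          _ = _ := by ring
      exact pos_of_mul_pos_left this (sq_nonneg _)
    have h2 : (a' * p) * (a * p) ≤ 0 := by
      calc (a' * p) * (a * p) = (a * a') * p ^ 2 := by ring
        _ ≤ 0 := mul_nonpos_of_nonpos_of_nonneg haa (sq_nonneg _)
    have h3 : a' * p ≤ 0 := by
      by_contra! h4
      exact absurd (mul_pos h4 hneg) (not_lt.2 h2)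
    linarith
  · by_contra! hneg
    have h1 : a' * p < 0 := by
      have : (a' * p) * p' ^ 2 < 0 := by
        calc (a' * p) * p' ^ 2 = (a' * p') * (p' * p) := by ring
          _ < 0 := mul_neg_of_neg_of_pos hneg hpp0
      by_contra! h4
      exact absurd (mul_nonneg h4 (sq_nonneg p')) (not_le.2 this)
    have h2 : (a * p') * (a' * p') ≤ 0 := by
      calc (a * p') * (a' * p') = (a * a') * p' ^ 2 := by ring
        _ ≤ 0 := mul_nonpos_of_nonpos_of_nonneg haa (sq_nonneg _)
    have h3 : 0 ≤ a * p' := by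
      by_contra! h4
      exact absurd (mul_pos_of_neg_of_neg h4 hneg) (not_lt.2 h2)
    linarith

/-- If two parameters satisfy the characteristic equation `p b + r a = (l - 1) M a b` and their
Cauchy data are close, then the displacement `a` does not change sign: otherwise `p / a` is of
order `l / η` and positive for the larger parameter, negative for the smaller one, so `r / b` is of
that order with the opposite signs. If `b` changes sign as well, this has the wrong direction;
otherwise `r` changes sign, and closeness makes `r / b` small. -/
theorem not_mul_nonpos {M b r b' r' : ℝ} (h₁ : CloseData l l' η a p a' p')
    (h₂ : CloseData l l' η b r b' r') (hM : 0 < M) (hl : 1 ≤ l) (hll : l ≤ l') (hll2 : l' ≤ 2 * l)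
    (hη : 0 < η) (hη8 : η ≤ 1 / 8) (hηM : 8 * M * η ≤ 1)
    (e : p * b + r * a = (l - 1) * M * a * b) (e' : p' * b' + r' * a' = (l' - 1) * M * a' * b')
    (haa : a * a' ≤ 0) : False := by
  obtain ⟨k, k'⟩ := h₁.of_mul_nonpos hl hll hη (by linarith) haa
  have hD₁ := h₁.pos
  have hD₂ := h₂.pos
  have hl0 : 0 < l := by linarith
  have hML : (l' - 1) * M * (8 * η) ≤ 2 * l := by
    have h1 : (l' - 1) * M * (8 * η) = (l' - 1) * (8 * M * η) := by ring
    have h2 : (l' - 1) * (8 * M * η) ≤ (l' - 1) * 1 := by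
      gcongr; linarith
    linarith
  by_cases ha : a = 0
  · subst ha
    have hp : p ≠ 0 := by rintro rfl; simp at hD₁
    have ha' : a' ≠ 0 := by rintro rfl; simp at hD₁
    have hb : b = 0 := by simpa [hp] using e
    subst hb
    have hb' : b' ≠ 0 := by rintro rfl; simp at hD₂
    obtain ⟨-, m'⟩ := h₂.of_mul_nonpos hl hll hη (by linarith) (by simp)
    have hab : 0 < a' ^ 2 * b' ^ 2 := by positivity
    have h1 : l * a' ^ 2 * b' ^ 2 ≤ 2 * η * (a' * p') * b' ^ 2 := by gcongr
    have h2 : l * b' ^ 2 * a' ^ 2 ≤ 2 * η * (b' * r') * a' ^ 2 := by gcongr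
    have h3 : 2 * η * (a' * p') * b' ^ 2 + 2 * η * (b' * r') * a' ^ 2
        = (l' - 1) * M * (8 * η) * (a' ^ 2 * b' ^ 2) / 4 := by
      calc _ = 2 * η * (p' * b' + r' * a') * (a' * b') := by ring
        _ = _ := by rw [e']; ring
    have h4 := mul_le_mul_of_nonneg_right hML hab.le
    have h5 : 0 < l * (a' ^ 2 * b' ^ 2) := by positivity
    linarith
  · have hb : b ≠ 0 := by
      rintro rfl
      have hr : r ≠ 0 := by rintro rfl; simp at hD₂
      simp [hr, ha] at e
    have ha2 : 0 < a ^ 2 := by positivity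
    have hrb : 0 < b * r := by
      have h1 : l * a ^ 2 * b ^ 2 ≤ 2 * η * -(a * p) * b ^ 2 := by gcongr
      have h2 : 2 * η * (b * r) * a ^ 2
          = 2 * η * -(a * p) * b ^ 2 + 2 * η * (l - 1) * M * (a ^ 2 * b ^ 2) := by
        calc _ = 2 * η * (p * b + r * a) * (a * b) - 2 * η * (a * p) * b ^ 2 := by ring
          _ = _ := by rw [e]; ring
      have h3 : 0 ≤ 2 * η * (l - 1) * M * (a ^ 2 * b ^ 2) := by
        have : 0 ≤ l - 1 := by linarith
        positivity
      have h4 : 0 < l * a ^ 2 * b ^ 2 := by positivity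
      have h5 : 0 < (b * r) * (2 * η * a ^ 2) := by linarith
      exact pos_of_mul_pos_left h5 (by positivity)
    have hbb : 0 < b * b' := by
      by_contra! hbb
      obtain ⟨m, -⟩ := h₂.of_mul_nonpos hl hll hη (by linarith) hbb
      have h1 : 0 ≤ l * b ^ 2 := by positivity
      have h2 : 0 < 2 * η * (b * r) := by positivity
      linarith
    have hb' : b' ≠ 0 := by rintro rfl; simp at hbb
    have ha' : a' ≠ 0 := by
      rintro rfl
      have hp' : p' ≠ 0 := by rintro rfl; simp at hD₁
      simp [hp', hb'] at e'
    have ha2' : 0 < a' ^ 2 := by positivity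
    have hrb' : l * b' ^ 2 ≤ 4 * η * -(b' * r') := by
      have h1 : l * a' ^ 2 * b' ^ 2 ≤ 2 * η * (a' * p') * b' ^ 2 := by gcongr
      have h2 : 2 * η * (a' * p') * b' ^ 2 + 2 * η * (b' * r') * a' ^ 2
          = (l' - 1) * M * (8 * η) * (a' ^ 2 * b' ^ 2) / 4 := by
        calc _ = 2 * η * (p' * b' + r' * a') * (a' * b') := by ring
          _ = _ := by rw [e']; ring
      have h3 := mul_le_mul_of_nonneg_right hML (by positivity : 0 ≤ a' ^ 2 * b' ^ 2)
      have h4 : a' ^ 2 * (l * b' ^ 2) ≤ a' ^ 2 * (4 * η * -(b' * r')) := by linarith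
      exact le_of_mul_le_mul_left h4 ha2'
    have hbr' : b' * r' < 0 := by
      have h1 : 0 < l * b' ^ 2 := by positivity
      by_contra! h2
      have : 0 ≤ 4 * η * (b' * r') := by positivity
      linarith
    have hrr : r * r' < 0 := by
      by_contra! h1
      have h2 : (b * r) * (b' * r') = (b * b') * (r * r') := by ring
      have h3 := mul_neg_of_pos_of_neg hrb hbr'
      have h4 := mul_nonneg hbb.le h1
      linarith
    have hr' : r' ≠ 0 := by rintro rfl; simp at hrr
    have hr2 : 0 < r' ^ 2 := by positivity
    have c1 : r' ^ 2 ≤ η ^ 2 * (b' ^ 2 + r' ^ 2 / l') := by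
      have h1 := h₂.close
      have h2 : 0 ≤ l * (b' - b) ^ 2 := by positivity
      linarith [sq_nonneg r]
    have c2 : r' ^ 2 / l' ≤ r' ^ 2 := div_le_self hr2.le (by linarith)
    have c3 : b' ^ 2 ≤ r' ^ 2 := by
      have h1 : b' ^ 2 ≤ l * b' ^ 2 := le_mul_of_one_le_left (sq_nonneg _) hl
      have h2 : 4 * η * -(b' * r') ≤ 1 / 2 * -(b' * r') := by
        gcongr
        · linarith
        · linarith
      linarith [sq_nonneg (b' + r')]
    have c4 : η ^ 2 * (b' ^ 2 + r' ^ 2 / l') ≤ 1 / 64 * (r' ^ 2 + r' ^ 2) := by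
      have : η ^ 2 ≤ 1 / 64 := by
        calc η ^ 2 ≤ (1 / 8) ^ 2 := by gcongr
          _ = _ := by norm_num
      have : 0 < l' := by linarith
      gcongr
    linarith

/-- Two distinct parameters which both satisfy the characteristic equation
`p b + r a = (l - 1) M a b` cannot have close Cauchy data. -/
theorem false_of_characteristic {M b r b' r' : ℝ} (h₁ : CloseData l l' η a p a' p')
    (h₂ : CloseData l l' η b r b' r') (hM : 0 < M) (hl : 1 ≤ l) (hll : l ≤ l') (hll2 : l' ≤ 2 * l)
    (hη : 0 < η) (hη8 : η ≤ 1 / 8) (hηM : 8 * M * η ≤ 1)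
    (e : p * b + r * a = (l - 1) * M * a * b)
    (e' : p' * b' + r' * a' = (l' - 1) * M * a' * b') : False := by
  rcases le_or_gt (a * a') 0 with haa | haa
  · exact h₁.not_mul_nonpos h₂ hM hl hll hll2 hη hη8 hηM e e' haa
  rcases le_or_gt (b * b') 0 with hbb | hbb
  · exact h₂.not_mul_nonpos h₁ hM hl hll hll2 hη hη8 hηM (by linarith) (by linarith) hbb
  -- without sign changes, `p / a + r / b` decreases, whereas `(l - 1) M` increases
  have h1 : 0 < (a' * p - a * p') * (b * b') := mul_pos h₁.pos hbb
  have h2 : 0 < (b' * r - b * r') * (a * a') := mul_pos h₂.pos haa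
  have h3 : (a' * p - a * p') * (b * b') + (b' * r - b * r') * (a * a')
      = (l - l') * (M * ((a * a') * (b * b'))) := by
    calc _ = (p * b + r * a) * (a' * b') - (p' * b' + r' * a') * (a * b) := by ring
      _ = _ := by rw [e, e']; ring
  have h4 : (l - l') * (M * ((a * a') * (b * b'))) ≤ 0 :=
    mul_nonpos_of_nonpos_of_nonneg (by linarith) (by positivity)
  linarith

end CloseData

/-! ### Prüfer phases -/

namespace Rod

/-- The right-hand side of the Prüfer equation `θ' = s (cos² θ / σ + ρ sin² θ) - (q / s) sin² θ`,
which governs the phase `θ` of a solution `y = R sin θ / s`, `p = R cos θ` with parameter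
`ν = s²`. -/
noncomputable def phaseField (r : Rod) (s t θ : ℝ) : ℝ :=
  s / r.σ t + (s * r.ρ t - r.q t / s - s / r.σ t) * Real.sin θ ^ 2

/-- A Lipschitz constant in `θ` for the Prüfer equation. -/
noncomputable def phaseLip (r : Rod) (s : ℝ) : ℝ := s * r.B + r.B / s + s / r.c

variable {r : Rod} {s : ℝ}

theorem phaseLip_nonneg (hs : 0 < s) : 0 ≤ r.phaseLip s := by
  have := r.B_pos
  have := r.c_pos
  unfold phaseLip; positivity

theorem div_σ_le (hs : 0 < s) {t : ℝ} (ht : t ∈ Icc (0 : ℝ) 1) :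
    0 < s / r.σ t ∧ s / r.σ t ≤ s / r.c :=
  ⟨div_pos hs (r.c_pos.trans_le (r.le_σ t ht)),
    div_le_div_of_nonneg_left hs.le r.c_pos (r.le_σ t ht)⟩

theorem abs_phaseCoeff_le (hs : 0 < s) {t : ℝ} (ht : t ∈ Icc (0 : ℝ) 1) :
    |s * r.ρ t - r.q t / s - s / r.σ t| ≤ r.phaseLip s := by
  have hc := r.c_pos
  have hB := r.B_pos
  obtain ⟨h1, h2⟩ := div_σ_le (r := r) hs ht
  have h3 : 0 < s * r.ρ t := mul_pos hs (hc.trans_le (r.le_ρ t ht))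
  have h4 : s * r.ρ t ≤ s * r.B := mul_le_mul_of_nonneg_left (r.ρ_le t ht) hs.le
  have h5 : 0 < r.q t / s := div_pos (hc.trans_le (r.le_q t ht)) hs
  have h6 : r.q t / s ≤ r.B / s := div_le_div_of_nonneg_right (r.q_le t ht) hs.le
  have h7 : 0 < s / r.c := div_pos hs hc
  have h8 : 0 < r.B / s := div_pos hB hs
  unfold phaseLip
  rw [abs_le]
  constructor <;> linarith

theorem lipschitzWith_sin_sq : LipschitzWith 1 (fun θ : ℝ => Real.sin θ ^ 2) := by
  refine LipschitzWith.of_dist_le_mul fun x z => ?_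
  rw [Real.dist_eq, Real.dist_eq, NNReal.coe_one, one_mul]
  have h : Real.sin x ^ 2 - Real.sin z ^ 2 = Real.sin (x + z) * Real.sin (x - z) := by
    rw [Real.sin_add, Real.sin_sub]
    have h1 := Real.sin_sq_add_cos_sq x
    have h2 := Real.sin_sq_add_cos_sq z
    linear_combination (-Real.sin x ^ 2) * h2 + (Real.sin z ^ 2) * h1
  rw [h, abs_mul]
  calc |Real.sin (x + z)| * |Real.sin (x - z)| ≤ 1 * |x - z| :=
        mul_le_mul (Real.abs_sin_le_one _) Real.abs_sin_le_abs (abs_nonneg _) zero_le_one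
    _ = _ := one_mul _

theorem lipschitzWith_phaseField (hs : 0 < s) {t : ℝ} (ht : t ∈ Icc (0 : ℝ) 1) :
    LipschitzWith (r.phaseLip s).toNNReal (r.phaseField s t) := by
  refine LipschitzWith.of_dist_le_mul fun x z => ?_
  have h := lipschitzWith_sin_sq.dist_le_mul x z
  rw [Real.dist_eq, NNReal.coe_one, one_mul] at h
  rw [Real.dist_eq, Real.coe_toNNReal _ (phaseLip_nonneg hs)]
  have : r.phaseField s t x - r.phaseField s t z
      = (s * r.ρ t - r.q t / s - s / r.σ t) * (Real.sin x ^ 2 - Real.sin z ^ 2) := by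
    unfold phaseField; ring
  rw [this, abs_mul]
  exact mul_le_mul (abs_phaseCoeff_le hs ht) h (abs_nonneg _) (phaseLip_nonneg hs)

theorem abs_phaseField_le (hs : 0 < s) {t : ℝ} (ht : t ∈ Icc (0 : ℝ) 1) (θ : ℝ) :
    |r.phaseField s t θ| ≤ s / r.c + r.phaseLip s := by
  obtain ⟨h1, h2⟩ := div_σ_le (r := r) hs ht
  unfold phaseField
  refine (abs_add_le _ _).trans (add_le_add ((abs_of_pos h1).trans_le h2) ?_)
  rw [abs_mul, abs_of_nonneg (sq_nonneg (Real.sin θ))]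
  calc _ ≤ r.phaseLip s * 1 :=
        mul_le_mul (abs_phaseCoeff_le hs ht) (Real.sin_sq_le_one θ) (sq_nonneg _)
          (phaseLip_nonneg hs)
    _ = _ := mul_one _

theorem exists_phase (r : Rod) (hs : 0 < s) (θ₀ : ℝ) : ∃ θ : ℝ → ℝ, θ 0 = θ₀ ∧
    ∀ t ∈ Icc (0 : ℝ) 1, HasDerivWithinAt θ (r.phaseField s t (θ t)) (Icc 0 1) t := by
  have hL : 0 ≤ s / r.c + r.phaseLip s :=
    add_nonneg (div_pos hs r.c_pos).le (phaseLip_nonneg hs)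
  have hPL : IsPicardLindelof (r.phaseField s) (tmin := 0) (tmax := 1) ⟨0, by simp⟩ θ₀
      (s / r.c + r.phaseLip s).toNNReal 0 (s / r.c + r.phaseLip s).toNNReal
      (r.phaseLip s).toNNReal := by
    refine ⟨fun t ht => (lipschitzWith_phaseField hs ht).lipschitzOnWith, ?_, ?_, ?_⟩
    · intro θ _
      have h1 : ContinuousOn (fun t => s / r.σ t) (Icc 0 1) :=
        continuousOn_const.div r.cont_σ σ_ne_zero
      exact h1.add ((((continuousOn_const.mul r.cont_ρ).sub (r.cont_q.div_const s)).sub h1).mul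
        continuousOn_const)
    · intro t ht θ _
      rw [Real.coe_toNNReal _ hL]
      exact abs_phaseField_le hs ht θ
    · simp
  exact hPL.exists_eq_forall_mem_Icc_hasDerivWithinAt₀

/-- From the phase one recovers a solution of the first-order system. -/
theorem exists_sol_of_phase (hs : 0 < s) {θ : ℝ → ℝ}
    (hθ : ∀ t ∈ Icc (0 : ℝ) 1, HasDerivWithinAt θ (r.phaseField s t (θ t)) (Icc 0 1) t) :
    ∃ (y p : ℝ → ℝ) (R : ℝ), 0 < R ∧ r.IsSol (s ^ 2) y p ∧ y 0 = Real.sin (θ 0) / s ∧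
      p 0 = Real.cos (θ 0) ∧ y 1 = R * Real.sin (θ 1) / s ∧ p 1 = R * Real.cos (θ 1) := by
  have cθ : ContinuousOn θ (Icc 0 1) := fun t ht => (hθ t ht).continuousWithinAt
  -- the logarithmic derivative of the amplitude
  set h : ℝ → ℝ := fun t =>
    Real.sin (θ t) * Real.cos (θ t) * (s / r.σ t + r.q t / s - s * r.ρ t) with hh
  have ch : ContinuousOn h (Icc 0 1) := by
    refine ((Real.continuous_sin.comp_continuousOn cθ).mul
      (Real.continuous_cos.comp_continuousOn cθ)).mul ?_
    exact ((continuousOn_const.div r.cont_σ σ_ne_zero).add (r.cont_q.div_const s)).sub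
      (continuousOn_const.mul r.cont_ρ)
  set k : ℝ → ℝ := IccExtend (zero_le_one (α := ℝ)) ((Icc (0 : ℝ) 1).domRestrict h) with hk
  have ck : Continuous k := (continuousOn_iff_continuous_domRestrict.1 ch).Icc_extend'
  have hkh : ∀ t ∈ Icc (0 : ℝ) 1, k t = h t := fun t ht => by
    rw [hk, IccExtend_of_mem _ _ ht]; rfl
  set R : ℝ → ℝ := fun t => Real.exp (∫ x in (0 : ℝ)..t, k x) with hR
  have dR : ∀ t ∈ Icc (0 : ℝ) 1, HasDerivWithinAt R (R t * h t) (Icc 0 1) t := by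
    intro t ht
    have h1 := (ck.integral_hasStrictDerivAt 0 t).hasDerivAt
    rw [hkh t ht] at h1
    exact h1.exp.hasDerivWithinAt
  have hs' := hs.ne'
  refine ⟨fun t => R t * Real.sin (θ t) / s, fun t => R t * Real.cos (θ t), R 1, Real.exp_pos _,
    fun t ht => ⟨?_, ?_⟩, by simp [hR], by simp [hR], rfl, rfl⟩
  · refine (((dR t ht).mul (hθ t ht).sin).div_const s).congr_deriv ?_
    have hσ := σ_ne_zero (r := r) t ht
    simp only [hh, phaseField]
    field_simp
    ring
  · refine ((dR t ht).mul (hθ t ht).cos).congr_deriv ?_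
    have hσ := σ_ne_zero (r := r) t ht
    simp only [hh, phaseField]
    have := Real.sin_sq_add_cos_sq (θ t)
    field_simp
    linear_combination (R t * Real.sin (θ t) * ((r.q t - s ^ 2 * r.ρ t) * r.σ t + s ^ 2)) * this

/-- The phase at the endpoint grows at least linearly in `s`. -/
theorem le_phase (hs : 0 < s) {θ : ℝ → ℝ}
    (hθ : ∀ t ∈ Icc (0 : ℝ) 1, HasDerivWithinAt θ (r.phaseField s t (θ t)) (Icc 0 1) t) :
    θ 0 + (s * min (1 / r.B) r.c - r.B / s) ≤ θ 1 := by
  have hc := r.c_pos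
  have hB := r.B_pos
  set m := s * min (1 / r.B) r.c - r.B / s with hm
  have hle : ∀ t ∈ Icc (0 : ℝ) 1, ∀ x, m ≤ r.phaseField s t x := by
    intro t ht x
    have hσ : 0 < r.σ t := hc.trans_le (r.le_σ t ht)
    have h1 : s * min (1 / r.B) r.c ≤ s / r.σ t := by
      calc _ ≤ s * (1 / r.B) := by gcongr; exact min_le_left _ _
        _ = s / r.B := by ring
        _ ≤ _ := div_le_div_of_nonneg_left hs.le hσ (r.σ_le t ht)
    have h2 : s * min (1 / r.B) r.c ≤ s * r.ρ t := by
      gcongr; exact (min_le_right _ _).trans (r.le_ρ t ht)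
    have h3 : r.q t / s ≤ r.B / s := div_le_div_of_nonneg_right (r.q_le t ht) hs.le
    have h4 := Real.sin_sq_le_one x
    have h5 := sq_nonneg (Real.sin x)
    have h6 : r.phaseField s t x = s / r.σ t * (1 - Real.sin x ^ 2)
        + s * r.ρ t * Real.sin x ^ 2 - r.q t / s * Real.sin x ^ 2 := by
      unfold phaseField; ring
    have h7 := mul_le_mul_of_nonneg_right h1 (by linarith : 0 ≤ 1 - Real.sin x ^ 2)
    have h8 := mul_le_mul_of_nonneg_right h2 h5
    have h9 := mul_le_mul_of_nonneg_right h3 h5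
    have h10 : r.B / s * Real.sin x ^ 2 ≤ r.B / s * 1 := by gcongr
    rw [h6, hm]
    linarith
  have hmono : MonotoneOn (fun t => θ t - m * t) (Icc 0 1) := by
    refine monotoneOn_of_hasDerivWithinAt_nonneg (convex_Icc 0 1)
      (f' := fun t => r.phaseField s t (θ t) - m * 1) ?_ ?_ ?_
    · exact ContinuousOn.sub (fun t ht => (hθ t ht).continuousWithinAt) (by fun_prop)
    · intro x hx
      rw [interior_Icc] at hx ⊢
      exact ((hasDerivAt_of_Icc (hθ x (Ioo_subset_Icc_self hx)) hx).sub
        ((hasDerivAt_id x).const_mul m)).hasDerivWithinAt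
    · intro x hx
      rw [interior_Icc] at hx
      have := hle x (Ioo_subset_Icc_self hx) (θ x)
      linarith
  have := hmono (by simp : (0 : ℝ) ∈ Icc (0 : ℝ) 1) (by simp : (1 : ℝ) ∈ Icc (0 : ℝ) 1) zero_le_one
  simp only [mul_zero, sub_zero, mul_one] at this
  linarith

theorem abs_phaseField_sub_le {s₀ : ℝ} {t : ℝ} (ht : t ∈ Icc (0 : ℝ) 1) (x : ℝ) :
    |r.phaseField s t x - r.phaseField s₀ t x|
      ≤ |s - s₀| * (1 / r.c + (r.B + 1 / r.c)) + r.B * |1 / s - 1 / s₀| := by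
  have hc := r.c_pos
  have hB := r.B_pos
  have hσ : 0 < r.σ t := hc.trans_le (r.le_σ t ht)
  have h1 : 1 / r.σ t ≤ 1 / r.c := one_div_le_one_div_of_le hc (r.le_σ t ht)
  have h0 : 0 < 1 / r.σ t := by positivity
  have hρ := hc.trans_le (r.le_ρ t ht)
  have hρB := r.ρ_le t ht
  have hq := hc.trans_le (r.le_q t ht)
  have h4 : |Real.sin x ^ 2| ≤ 1 := by
    rw [abs_of_nonneg (sq_nonneg _)]; exact Real.sin_sq_le_one x
  have h2 : r.phaseField s t x - r.phaseField s₀ t x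
      = (s - s₀) * (1 / r.σ t + (r.ρ t - 1 / r.σ t) * Real.sin x ^ 2)
        - r.q t * (1 / s - 1 / s₀) * Real.sin x ^ 2 := by
    unfold phaseField; ring
  rw [h2]
  refine (abs_sub _ _).trans (add_le_add ?_ ?_)
  · rw [abs_mul]
    gcongr
    refine (abs_add_le _ _).trans (add_le_add ((abs_of_pos h0).trans_le h1) ?_)
    rw [abs_mul]
    have h3 : |r.ρ t - 1 / r.σ t| ≤ r.B + 1 / r.c := by
      rw [abs_le]; constructor <;> linarith
    calc _ ≤ (r.B + 1 / r.c) * 1 := mul_le_mul h3 h4 (abs_nonneg _) (by positivity)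
      _ = _ := mul_one _
  · rw [abs_mul, abs_mul, abs_of_pos hq]
    calc _ ≤ r.B * |1 / s - 1 / s₀| * 1 := by
          gcongr
          exact r.q_le t ht
      _ = _ := mul_one _

/-- Polar coordinates for the solutions with initial phase `θ₀`: the phase `Θ s` at the endpoint `1`
of the solution with parameter `s²` depends continuously on `s` and tends to infinity. -/
theorem exists_polar (r : Rod) (θ₀ : ℝ) : ∃ Θ : ℝ → ℝ, ContinuousOn Θ (Ioi 0) ∧
    Tendsto Θ atTop atTop ∧ ∀ s > 0, ∃ (y p : ℝ → ℝ) (R : ℝ), 0 < R ∧ r.IsSol (s ^ 2) y p ∧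
      y 0 = Real.sin θ₀ / s ∧ p 0 = Real.cos θ₀ ∧
      y 1 = R * Real.sin (Θ s) / s ∧ p 1 = R * Real.cos (Θ s) := by
  have hex : ∀ s : ℝ, ∃ θ : ℝ → ℝ, 0 < s → θ 0 = θ₀ ∧
      ∀ t ∈ Icc (0 : ℝ) 1, HasDerivWithinAt θ (r.phaseField s t (θ t)) (Icc 0 1) t := by
    intro s
    rcases lt_or_ge 0 s with hs | hs
    · obtain ⟨θ, hθ⟩ := r.exists_phase hs θ₀
      exact ⟨θ, fun _ => hθ⟩
    · exact ⟨0, fun h => absurd h (not_lt.2 hs)⟩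
  choose θ hθ using hex
  refine ⟨fun s => θ s 1, ?_, ?_, ?_⟩
  · intro s₀ hs₀
    have hs₀' : (0 : ℝ) < s₀ := hs₀
    refine ContinuousAt.continuousWithinAt ?_
    set ε : ℝ → ℝ := fun s =>
      |s - s₀| * (1 / r.c + (r.B + 1 / r.c)) + r.B * |1 / s - 1 / s₀| with hε
    have hεc : ContinuousAt ε s₀ := by
      have : ContinuousAt (fun s : ℝ => 1 / s) s₀ :=
        continuousAt_const.div continuousAt_id hs₀'.ne'
      exact ((continuousAt_id.sub continuousAt_const).abs.mul continuousAt_const).add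
        (continuousAt_const.mul (this.sub continuousAt_const).abs)
    have hε0 : ε s₀ = 0 := by simp [hε]
    have hgron : Tendsto (fun s => gronwallBound 0 (r.phaseLip s₀).toNNReal (ε s + 0) (1 - 0))
        (𝓝 s₀) (𝓝 0) := by
      have h1 : ContinuousAt
          (fun s => gronwallBound 0 (r.phaseLip s₀).toNNReal (ε s + 0) (1 - 0)) s₀ :=
        (gronwallBound_continuous_ε 0 _ (1 - 0)).continuousAt.comp
          (hεc.add continuousAt_const)
      have h2 := h1.tendsto
      rwa [hε0, add_zero, gronwallBound_ε0_δ0] at h2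
    rw [ContinuousAt, tendsto_iff_dist_tendsto_zero]
    refine squeeze_zero' (Eventually.of_forall fun _ => dist_nonneg) ?_ hgron
    filter_upwards [Ioi_mem_nhds hs₀'] with s hs
    obtain ⟨i1, d1⟩ := hθ s hs
    obtain ⟨i2, d2⟩ := hθ s₀ hs₀'
    have hright : ∀ {s : ℝ}, (∀ t ∈ Icc (0 : ℝ) 1, HasDerivWithinAt (θ s)
        (r.phaseField s t (θ s t)) (Icc 0 1) t) → ∀ t ∈ Ico (0 : ℝ) 1, HasDerivWithinAt (θ s)
        (r.phaseField s t (θ s t)) (Ici t) t := fun hd t ht =>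
      (hd t (Ico_subset_Icc_self ht)).mono_of_mem_nhdsWithin
        (mem_of_superset (Icc_mem_nhdsGE ht.2) (Icc_subset_Icc_left ht.1))
    exact dist_le_of_approx_trajectories_ODE_of_mem (v := r.phaseField s₀)
      (s := fun _ => univ)
      (fun t ht => (lipschitzWith_phaseField hs₀' (Ico_subset_Icc_self ht)).lipschitzOnWith)
      (fun t ht => (d1 t ht).continuousWithinAt) (hright d1)
      (fun t ht => abs_phaseField_sub_le (Ico_subset_Icc_self ht) _) (fun _ _ => mem_univ _)
      (fun t ht => (d2 t ht).continuousWithinAt) (hright d2)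
      (fun t ht => (dist_self _).le) (fun _ _ => mem_univ _) (by rw [i1, i2, dist_self])
      1 (by simp)
  · have hm : 0 < min (1 / r.B) r.c := lt_min (by have := r.B_pos; positivity) r.c_pos
    have hlim : Tendsto (fun s : ℝ => θ₀ - r.B + s * min (1 / r.B) r.c) atTop atTop :=
      tendsto_atTop_add_const_left _ _ (tendsto_id.atTop_mul_const hm)
    refine tendsto_atTop_mono' _ ?_ hlim
    filter_upwards [eventually_ge_atTop 1] with s hs
    obtain ⟨i1, d1⟩ := hθ s (by linarith)
    have h1 := le_phase (by linarith) d1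
    have h2 : r.B / s ≤ r.B := div_le_self r.B_pos.le hs
    rw [i1] at h1
    linarith
  · intro s hs
    obtain ⟨i1, d1⟩ := hθ s hs
    have h := exists_sol_of_phase hs d1
    rwa [i1] at h

end Rod

/-! ### From Sturm-Liouville equations to first-order systems -/

/-- An affine change of variable `g t = e t + k` with `e = ±1` transforms solutions into solutions;
a reflection changes the sign of the flux. -/
theorem SLSystem.comp_affine {a b a' b' ν e k : ℝ} {ρ σ q y p : ℝ → ℝ}
    (h : SLSystem a' b' ρ σ q ν y p) (he : e * e = 1)
    (hg : MapsTo (fun t => e * t + k) (Icc a b) (Icc a' b')) :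
    SLSystem a b (fun t => ρ (e * t + k)) (fun t => σ (e * t + k)) (fun t => q (e * t + k)) ν
      (fun t => y (e * t + k)) (fun t => e * p (e * t + k)) := by
  intro t ht
  have dg : HasDerivWithinAt (fun t => e * t + k) (e * 1) (Icc a b) t :=
    (((hasDerivAt_id t).const_mul e).add_const k).hasDerivWithinAt
  obtain ⟨h1, h2⟩ := h _ (hg ht)
  refine ⟨(h1.comp t dg hg).congr_deriv (by ring), ((h2.comp t dg hg).const_mul e).congr_deriv ?_⟩
  calc _ = (e * e) * ((q (e * t + k) - ν * ρ (e * t + k)) * y (e * t + k)) := by ring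
    _ = _ := by rw [he, one_mul]

/-- Absolute continuity only depends on the values of the function on the interval. -/
theorem AbsolutelyContinuousOnInterval.congr_uIcc {f g : ℝ → ℝ} {a b : ℝ}
    (hf : AbsolutelyContinuousOnInterval f a b) (hfg : ∀ x ∈ uIcc a b, g x = f x) :
    AbsolutelyContinuousOnInterval g a b := by
  refine Tendsto.congr' ?_ hf
  filter_upwards [mem_inf_of_right (mem_principal_self _)] with E hE
  refine Finset.sum_congr rfl fun i hi => ?_
  rw [hfg _ (hE.1 i hi).1, hfg _ (hE.1 i hi).2]

theorem AbsolutelyContinuousOnInterval.of_eq_primitive {f f' : ℝ → ℝ} {a b : ℝ} (hab : a ≤ b)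
    (hI : IntervalIntegrable f' volume a b)
    (hf : ∀ x ∈ Icc a b, f x = f a + ∫ t in a..x, f' t) :
    AbsolutelyContinuousOnInterval f a b := by
  have h1 := hI.absolutelyContinuousOnInterval_intervalIntegral (c := a) left_mem_uIcc
  have h2 : AbsolutelyContinuousOnInterval (fun _ : ℝ => f a) a b :=
    (LipschitzWith.const (f a)).lipschitzOnWith.absolutelyContinuousOnInterval
  refine (h2.add h1).congr_uIcc ?_
  rw [uIcc_of_le hab]
  exact hf

theorem hasDerivWithinAt_of_eq_primitive {f f' : ℝ → ℝ} {a b : ℝ} (hc : ContinuousOn f' (Icc a b))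
    (hf : ∀ x ∈ Icc a b, f x = f a + ∫ t in a..x, f' t) {x : ℝ} (hx : x ∈ Icc a b) :
    HasDerivWithinAt f (f' x) (Icc a b) x := by
  have : Fact (x ∈ Icc a b) := ⟨hx⟩
  have h1 : IntervalIntegrable f' volume a x :=
    (hc.mono (by rw [uIcc_of_le hx.1]; exact Icc_subset_Icc_right hx.2)).intervalIntegrable
  have h3 : HasDerivWithinAt (fun x => ∫ t in a..x, f' t) (f' x) (Icc a b) x :=
    intervalIntegral.integral_hasDerivWithinAt_right h1
      (hc.stronglyMeasurableAtFilter_nhdsWithin measurableSet_Icc x) (hc x hx)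
  exact (h3.const_add (f a)).congr hf (hf x hx)

theorem eq_primitive_of_hasDerivWithinAt {f f' : ℝ → ℝ} {a b : ℝ} (hc : ContinuousOn f' (Icc a b))
    (hf : ∀ x ∈ Icc a b, HasDerivWithinAt f (f' x) (Icc a b) x) {x : ℝ} (hx : x ∈ Icc a b) :
    f x = f a + ∫ t in a..x, f' t := by
  have hsub : Icc a x ⊆ Icc a b := Icc_subset_Icc_right hx.2
  have := intervalIntegral.integral_eq_sub_of_hasDerivAt_of_le hx.1
    (f := f) (f' := f') (fun t ht => ((hf t (hsub ht)).continuousWithinAt).mono hsub)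
    (fun t ht => hasDerivAt_of_Icc (hf t (hsub (Ioo_subset_Icc_self ht)))
      ⟨ht.1, ht.2.trans_le hx.2⟩)
    ((hc.mono hsub).mono (by rw [uIcc_of_le hx.1])).intervalIntegrable
  rw [this]; ring

/-- A function of class `H²` is absolutely continuous and continuously differentiable, and its
derivative is absolutely continuous. -/
theorem MemH2.exists_deriv {a b : ℝ} {f : ℝ → ℝ} (hab : a ≤ b) (h : MemH2 a b f) :
    ∃ f' : ℝ → ℝ, (∀ x ∈ Icc a b, HasDerivWithinAt f (f' x) (Icc a b) x) ∧
      ContinuousOn f' (Icc a b) ∧ AbsolutelyContinuousOnInterval f a b ∧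
      AbsolutelyContinuousOnInterval f' a b := by
  obtain ⟨f', f'', h2, hf, hf'⟩ := h
  have hI : IntervalIntegrable f'' volume a b := by
    rw [intervalIntegrable_iff_integrableOn_Ioo_of_le hab]
    exact h2.integrable (by norm_num)
  have hAC := AbsolutelyContinuousOnInterval.of_eq_primitive hab hI hf'
  have hc : ContinuousOn f' (Icc a b) := by
    have := hAC.continuousOn
    rwa [uIcc_of_le hab] at this
  have hI' : IntervalIntegrable f' volume a b :=
    ContinuousOn.intervalIntegrable (by rwa [uIcc_of_le hab])
  exact ⟨f', fun x hx => hasDerivWithinAt_of_eq_primitive hc hf hx, hc,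
    AbsolutelyContinuousOnInterval.of_eq_primitive hab hI' hf, hAC⟩

theorem MemH2.continuousOn {a b : ℝ} {f : ℝ → ℝ} (hab : a ≤ b) (h : MemH2 a b f) :
    ContinuousOn f (Icc a b) := by
  obtain ⟨f', hf, -⟩ := h.exists_deriv hab
  exact fun x hx => (hf x hx).continuousWithinAt

theorem UniformlyPositiveOn.ne_zero {a b : ℝ} {f : ℝ → ℝ} (h : UniformlyPositiveOn a b f) :
    ∀ x ∈ Icc a b, f x ≠ 0 := by
  obtain ⟨c, hc, h⟩ := h
  exact fun x hx => (hc.trans_le (h x hx)).ne'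

section Conversion

variable {a b ν : ℝ} {ρ σ q y : ℝ → ℝ}

theorem eventuallyEq_flux {y' : ℝ → ℝ}
    (hy : ∀ x ∈ Icc a b, HasDerivWithinAt y (y' x) (Icc a b) x) {x : ℝ} (hx : x ∈ Ioo a b) :
    (fun s => σ s * deriv y s) =ᶠ[𝓝 x] fun s => σ s * y' s := by
  filter_upwards [isOpen_Ioo.mem_nhds hx] with s hs
  rw [(hasDerivAt_of_Icc (hy s (Ioo_subset_Icc_self hs)) hs).deriv]

/-- An `H²` solution of the Sturm-Liouville equation, in the almost everywhere sense, solves the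
first-order system in the classical sense: its flux is absolutely continuous with an almost
everywhere derivative which agrees with a continuous function. -/
theorem SolvesSturmLiouville.exists_system (hab : a < b) (hρ : ContinuousOn ρ (Icc a b))
    (hσ : MemH2 a b σ) (hσ0 : UniformlyPositiveOn a b σ) (hq : ContinuousOn q (Icc a b))
    (h : SolvesSturmLiouville a b ρ σ q ν y) : ∃ p, SLSystem a b ρ σ q ν y p := by
  obtain ⟨hy, heq⟩ := h
  obtain ⟨y', dy, cy', -, acy'⟩ := hy.exists_deriv hab.le
  obtain ⟨σ', -, -, acσ, -⟩ := hσ.exists_deriv hab.le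
  have cy := hy.continuousOn hab.le
  set p : ℝ → ℝ := fun x => σ x * y' x with hp
  have acp : AbsolutelyContinuousOnInterval p a b := acσ.fun_mul acy'
  have cG : ContinuousOn (fun x => (q x - ν * ρ x) * y x) (Icc a b) :=
    (hq.sub (continuousOn_const.mul hρ)).mul cy
  have hprim : ∀ x ∈ Icc a b, p x = p a + ∫ t in a..x, (q t - ν * ρ t) * y t := by
    intro x hx
    have acx : AbsolutelyContinuousOnInterval p a x := by
      refine acp.mono ?_
      rw [uIcc_of_le hx.1, uIcc_of_le hab.le]
      exact Icc_subset_Icc_right hx.2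
    have h1 : ∫ t in a..x, deriv p t = ∫ t in a..x, (q t - ν * ρ t) * y t := by
      refine intervalIntegral.integral_congr_ae ?_
      rw [ae_restrict_iff' measurableSet_Ioo] at heq
      have hb : ∀ᵐ t : ℝ, t ≠ b := by simp [ae_iff]
      filter_upwards [heq, hb] with t ht htb hmem
      rw [uIoc_of_le hx.1] at hmem
      have hmem' : t ∈ Ioo a b := ⟨hmem.1, lt_of_le_of_ne (hmem.2.trans hx.2) htb⟩
      have h2 := ht hmem'
      rw [(eventuallyEq_flux dy hmem').deriv_eq] at h2
      linarith
    rw [← h1, acx.integral_deriv_eq_sub]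
    ring
  refine ⟨p, fun x hx => ⟨(dy x hx).congr_deriv ?_, hasDerivWithinAt_of_eq_primitive cG hprim hx⟩⟩
  rw [hp, mul_div_cancel_left₀ _ (hσ0.ne_zero x hx)]

theorem SLSystem.solvesSturmLiouville {p : ℝ → ℝ} (hab : a < b) (hρ : ContinuousOn ρ (Icc a b))
    (hσ : MemH2 a b σ) (hσ0 : UniformlyPositiveOn a b σ) (hq : ContinuousOn q (Icc a b))
    (h : SLSystem a b ρ σ q ν y p) : SolvesSturmLiouville a b ρ σ q ν y := by
  obtain ⟨cy, cp⟩ := h.continuousOn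
  obtain ⟨σ', dσ, cσ', -, -⟩ := hσ.exists_deriv hab.le
  have cσ := hσ.continuousOn hab.le
  have hσ0 := hσ0.ne_zero
  have cy' : ContinuousOn (fun x => p x / σ x) (Icc a b) := cp.div cσ hσ0
  have cy'' : ContinuousOn (fun x => ((q x - ν * ρ x) * y x * σ x - p x * σ' x) / σ x ^ 2)
      (Icc a b) :=
    ((((hq.sub (continuousOn_const.mul hρ)).mul cy).mul cσ).sub (cp.mul cσ')).div (cσ.pow 2)
      (fun x hx => pow_ne_zero 2 (hσ0 x hx))
  refine ⟨⟨fun x => p x / σ x, fun x => ((q x - ν * ρ x) * y x * σ x - p x * σ' x) / σ x ^ 2,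
    ?_, fun x hx => eq_primitive_of_hasDerivWithinAt cy' (fun t ht => (h t ht).1) hx,
    fun x hx => eq_primitive_of_hasDerivWithinAt cy''
      (fun t ht => (h t ht).2.div (dσ t ht) (hσ0 t ht)) hx⟩, ?_⟩
  · rw [memLp_two_iff_integrable_sq
      ((cy''.mono Ioo_subset_Icc_self).aestronglyMeasurable measurableSet_Ioo)]
    exact ((cy''.pow 2).integrableOn_Icc).mono_set Ioo_subset_Icc_self
  · refine (ae_restrict_iff' measurableSet_Ioo).2 (Eventually.of_forall fun x hx => ?_)
    have h1 : (fun s => σ s * deriv y s) =ᶠ[𝓝 x] p := by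
      filter_upwards [eventuallyEq_flux (σ := σ) (fun t ht => (h t ht).1) hx,
        isOpen_Ioo.mem_nhds hx] with s hs hs'
      rw [hs, mul_div_cancel₀ _ (hσ0 s (Ioo_subset_Icc_self hs'))]
    rw [h1.deriv_eq, (hasDerivAt_of_Icc (h x (Ioo_subset_Icc_self hx)).2 hx).deriv]
    ring

/-- The rod on `[0, 1]` obtained from coefficients on `[a, b]` by an affine change of variable. -/
theorem exists_rod {e k : ℝ} (hab : a ≤ b) (he : e * e = 1)
    (hg : MapsTo (fun t => e * t + k) (Icc 0 1) (Icc a b))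
    (hρ : MemH2 a b ρ) (hσ : MemH2 a b σ) (hq : ContinuousOn q (Icc a b))
    (hρ0 : UniformlyPositiveOn a b ρ) (hσ0 : UniformlyPositiveOn a b σ)
    (hq0 : UniformlyPositiveOn a b q) :
    ∃ r : Rod, r.ρ = (fun t => ρ (e * t + k)) ∧ r.σ = (fun t => σ (e * t + k)) ∧
      r.q = (fun t => q (e * t + k)) := by
  obtain ⟨ρ', dρ, cρ', -, -⟩ := hρ.exists_deriv hab
  obtain ⟨σ', dσ, cσ', -, -⟩ := hσ.exists_deriv hab
  have bdd : ∀ f : ℝ → ℝ, ContinuousOn f (Icc a b) → ∃ C, ∀ x ∈ Icc a b, |f x| ≤ C := fun f hf =>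
    isCompact_Icc.exists_bound_of_continuousOn hf
  obtain ⟨B₁, h1⟩ := bdd _ (hρ.continuousOn hab)
  obtain ⟨B₂, h2⟩ := bdd _ (hσ.continuousOn hab)
  obtain ⟨B₃, h3⟩ := bdd _ hq
  obtain ⟨B₄, h4⟩ := bdd _ cρ'
  obtain ⟨B₅, h5⟩ := bdd _ cσ'
  obtain ⟨c₁, hc1, l1⟩ := hρ0
  obtain ⟨c₂, hc2, l2⟩ := hσ0
  obtain ⟨c₃, hc3, l3⟩ := hq0
  have ha : a ∈ Icc a b := left_mem_Icc.2 hab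
  have p1 := (abs_nonneg _).trans (h1 a ha)
  have p2 := (abs_nonneg _).trans (h2 a ha)
  have p3 := (abs_nonneg _).trans (h3 a ha)
  have p4 := (abs_nonneg _).trans (h4 a ha)
  have p5 := (abs_nonneg _).trans (h5 a ha)
  have habs : |e| = 1 := by
    rcases mul_self_eq_one_iff.1 he with rfl | rfl <;> simp
  have dg : ∀ t, HasDerivWithinAt (fun t => e * t + k) (e * 1) (Icc 0 1) t := fun t =>
    (((hasDerivAt_id t).const_mul e).add_const k).hasDerivWithinAt
  refine ⟨{ ρ := fun t => ρ (e * t + k), σ := fun t => σ (e * t + k), q := fun t => q (e * t + k)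
            dρ := fun t => ρ' (e * t + k) * (e * 1), dσ := fun t => σ' (e * t + k) * (e * 1)
            c := min c₁ (min c₂ c₃), B := B₁ + B₂ + B₃ + B₄ + B₅
            c_pos := lt_min hc1 (lt_min hc2 hc3)
            hasDeriv_ρ := fun t ht => (dρ _ (hg ht)).comp t (dg t) hg
            hasDeriv_σ := fun t ht => (dσ _ (hg ht)).comp t (dg t) hg
            cont_q := hq.comp (by fun_prop) hg
            le_ρ := fun t ht => (min_le_left _ _).trans (l1 _ (hg ht))
            le_σ := fun t ht =>
              ((min_le_right _ _).trans (min_le_left _ _)).trans (l2 _ (hg ht))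
            le_q := fun t ht =>
              ((min_le_right _ _).trans (min_le_right _ _)).trans (l3 _ (hg ht))
            ρ_le := fun t ht => by
              have := (le_abs_self _).trans (h1 _ (hg ht))
              linarith
            σ_le := fun t ht => by
              have := (le_abs_self _).trans (h2 _ (hg ht))
              linarith
            q_le := fun t ht => by
              have := (le_abs_self _).trans (h3 _ (hg ht))
              linarith
            dρ_le := fun t ht => by
              have := h4 _ (hg ht)
              rw [mul_one, abs_mul, habs, mul_one]
              linarith
            dσ_le := fun t ht => by
              have := h5 _ (hg ht)
              rw [mul_one, abs_mul, habs, mul_one]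
              linarith }, rfl, rfl, rfl⟩

/-- Pullback of a solution of the Sturm-Liouville equation to the rod on `[0, 1]`. -/
theorem SolvesSturmLiouville.exists_isSol {e k : ℝ} {r : Rod} (hab : a < b) (he : e * e = 1)
    (hg : MapsTo (fun t => e * t + k) (Icc 0 1) (Icc a b))
    (hρ : MemH2 a b ρ) (hσ : MemH2 a b σ) (hq : ContinuousOn q (Icc a b))
    (hσ0 : UniformlyPositiveOn a b σ) (rρ : r.ρ = fun t => ρ (e * t + k))
    (rσ : r.σ = fun t => σ (e * t + k)) (rq : r.q = fun t => q (e * t + k))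
    (h : SolvesSturmLiouville a b ρ σ q ν y) :
    ∃ p, r.IsSol ν (fun t => y (e * t + k)) p ∧ ∀ t ∈ Icc (0 : ℝ) 1,
      p t = e * (σ (e * t + k) * derivWithin y (Icc a b) (e * t + k)) := by
  obtain ⟨p, hp⟩ := h.exists_system hab (hρ.continuousOn hab.le) hσ hσ0 hq
  refine ⟨fun t => e * p (e * t + k), ?_, fun t ht => ?_⟩
  · unfold Rod.IsSol
    rw [rρ, rσ, rq]
    exact hp.comp_affine he hg
  · rw [((hp _ (hg ht)).1.derivWithin (uniqueDiffOn_Icc hab _ (hg ht))),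
      mul_div_cancel₀ _ (hσ0.ne_zero _ (hg ht))]

/-- Push-forward of a solution on the rod `[0, 1]` to the interval `[a, b]`. -/
theorem Rod.IsSol.solvesSturmLiouville {e k : ℝ} {r : Rod} {p : ℝ → ℝ} (hab : a < b)
    (he : e * e = 1) (hg : MapsTo (fun x => e * x + -(e * k)) (Icc a b) (Icc 0 1))
    (hρ : MemH2 a b ρ) (hσ : MemH2 a b σ) (hq : ContinuousOn q (Icc a b))
    (hσ0 : UniformlyPositiveOn a b σ) (rρ : r.ρ = fun t => ρ (e * t + k))
    (rσ : r.σ = fun t => σ (e * t + k)) (rq : r.q = fun t => q (e * t + k))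
    (h : r.IsSol ν y p) :
    SolvesSturmLiouville a b ρ σ q ν (fun x => y (e * x + -(e * k))) ∧ ∀ x ∈ Icc a b,
      σ x * derivWithin (fun x => y (e * x + -(e * k))) (Icc a b) x
        = e * p (e * x + -(e * k)) := by
  have hinv : ∀ x, e * (e * x + -(e * k)) + k = x := fun x => by
    linear_combination (x - k) * he
  have hsys := SLSystem.comp_affine (k := -(e * k)) h he hg
  rw [rρ, rσ, rq] at hsys
  simp only [hinv] at hsys
  refine ⟨hsys.solvesSturmLiouville hab (hρ.continuousOn hab.le) hσ hσ0 hq, fun x hx => ?_⟩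
  rw [(hsys x hx).1.derivWithin (uniqueDiffOn_Icc hab x hx),
    mul_div_cancel₀ _ (hσ0.ne_zero x hx)]

end Conversion

/-! ### Pairs of rods joined by a mass -/

/-- Two rods on `[0, 1]`, joined at their endpoints `1` by a mass `M`, with a Dirichlet condition at
the endpoint `0` of the first one and a Neumann condition at the endpoint `0` of the second one.
Both fluxes at the joint point towards the mass. -/
structure IsPairSol (r₁ r₂ : Rod) (M ν : ℝ) (y₁ p₁ y₂ p₂ : ℝ → ℝ) : Prop where
  left : r₁.IsSol ν y₁ p₁
  right : r₂.IsSol ν y₂ p₂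
  dirichlet : y₁ 0 = 0
  neumann : p₂ 0 = 0
  continuity : y₁ 1 = y₂ 1
  mass : p₁ 1 + p₂ 1 = ν * M * y₁ 1

/-- The parameter `ν` admits a pair solution which does not vanish identically. -/
def IsPairEigenvalue (r₁ r₂ : Rod) (M ν : ℝ) : Prop :=
  ∃ y₁ p₁ y₂ p₂, IsPairSol r₁ r₂ M ν y₁ p₁ y₂ p₂ ∧
    ¬ ((∀ t ∈ Icc (0 : ℝ) 1, y₁ t = 0) ∧ ∀ t ∈ Icc (0 : ℝ) 1, y₂ t = 0)

/-- For `ν ≤ 0` the product `y p` is nondecreasing along a solution. -/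
theorem Rod.IsSol.mul_nonneg_of_nonpos {r : Rod} {ν : ℝ} (hν : ν ≤ 0) {y p : ℝ → ℝ}
    (h : r.IsSol ν y p) (h0 : y 0 * p 0 = 0) :
    0 ≤ y 1 * p 1 ∧ (y 1 * p 1 = 0 → ∀ t ∈ Icc (0 : ℝ) 1, y t = 0) := by
  have hc := r.c_pos
  set f : ℝ → ℝ := fun t => y t * p t with hf
  set f' : ℝ → ℝ := fun t => p t / r.σ t * p t + y t * ((r.q t - ν * r.ρ t) * y t) with hf'
  have df : ∀ t ∈ Icc (0 : ℝ) 1, HasDerivWithinAt f (f' t) (Icc 0 1) t := fun t ht =>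
    (h t ht).1.mul (h t ht).2
  have hlow : ∀ t ∈ Icc (0 : ℝ) 1, r.c * y t ^ 2 ≤ f' t := by
    intro t ht
    have hσ := hc.trans_le (r.le_σ t ht)
    have hρ := hc.trans_le (r.le_ρ t ht)
    have h1 : 0 ≤ p t / r.σ t * p t := by
      rw [div_mul_eq_mul_div]; exact div_nonneg (mul_self_nonneg _) hσ.le
    have h2 : r.c ≤ r.q t - ν * r.ρ t := by
      have := mul_nonneg (neg_nonneg.2 hν) hρ.le
      have := r.le_q t ht
      linarith
    have h3 := mul_le_mul_of_nonneg_right h2 (sq_nonneg (y t))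
    simp only [hf']
    linarith
  have hmono : MonotoneOn f (Icc 0 1) := by
    refine monotoneOn_of_hasDerivWithinAt_nonneg (convex_Icc 0 1) (f' := f')
      (fun t ht => (df t ht).continuousWithinAt) ?_ ?_
    · intro x hx
      rw [interior_Icc] at hx ⊢
      exact (hasDerivAt_of_Icc (df x (Ioo_subset_Icc_self hx)) hx).hasDerivWithinAt
    · intro x hx
      rw [interior_Icc] at hx
      exact (mul_nonneg hc.le (sq_nonneg _)).trans (hlow x (Ioo_subset_Icc_self hx))
  have m0 : (0 : ℝ) ∈ Icc (0 : ℝ) 1 := by simp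
  have m1 : (1 : ℝ) ∈ Icc (0 : ℝ) 1 := by simp
  refine ⟨h0 ▸ hmono m0 m1 zero_le_one, fun h1 t ht => ?_⟩
  have hzero : ∀ x ∈ Icc (0 : ℝ) 1, f x = 0 := fun x hx =>
    le_antisymm (h1 ▸ hmono hx m1 hx.2) (h0 ▸ hmono m0 hx hx.1)
  have hd : f' t = 0 := (uniqueDiffOn_Icc zero_lt_one t ht).eq_deriv _ (df t ht)
    ((hasDerivWithinAt_const t (Icc 0 1) (0 : ℝ)).congr hzero (hzero t ht))
  have h3 := hlow t ht
  rw [hd] at h3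
  have h4 : y t ^ 2 ≤ 0 := by
    by_contra! h5
    have := mul_pos hc h5
    linarith
  simpa using le_antisymm h4 (sq_nonneg _)

namespace IsPairSol

variable {r₁ r₂ : Rod} {M ν : ℝ} {y₁ p₁ y₂ p₂ : ℝ → ℝ}

theorem sub_smul {z₁ w₁ z₂ w₂ : ℝ → ℝ} (h : IsPairSol r₁ r₂ M ν y₁ p₁ y₂ p₂)
    (h' : IsPairSol r₁ r₂ M ν z₁ w₁ z₂ w₂) (k : ℝ) :
    IsPairSol r₁ r₂ M ν (fun t => y₁ t - k * z₁ t) (fun t => p₁ t - k * w₁ t)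
      (fun t => y₂ t - k * z₂ t) (fun t => p₂ t - k * w₂ t) where
  left := h.left.sub_smul h'.left k
  right := h.right.sub_smul h'.right k
  dirichlet := by simp [h.dirichlet, h'.dirichlet]
  neumann := by simp [h.neumann, h'.neumann]
  continuity := by simp [h.continuity, h'.continuity]
  mass := by linear_combination h.mass - k * h'.mass

theorem pos_of_ne_zero (hM : 0 < M) (h : IsPairSol r₁ r₂ M ν y₁ p₁ y₂ p₂)
    (hne : ¬ ((∀ t ∈ Icc (0 : ℝ) 1, y₁ t = 0) ∧ ∀ t ∈ Icc (0 : ℝ) 1, y₂ t = 0)) : 0 < ν := by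
  by_contra! hν
  obtain ⟨n1, z1⟩ := h.left.mul_nonneg_of_nonpos hν (by simp [h.dirichlet])
  obtain ⟨n2, z2⟩ := h.right.mul_nonneg_of_nonpos hν (by simp [h.neumann])
  have hsum : y₁ 1 * p₁ 1 + y₂ 1 * p₂ 1 = ν * (M * y₁ 1 ^ 2) := by
    rw [← h.continuity]; linear_combination y₁ 1 * h.mass
  have hle : ν * (M * y₁ 1 ^ 2) ≤ 0 := mul_nonpos_of_nonpos_of_nonneg hν (by positivity)
  exact hne ⟨z1 (by linarith), z2 (by linarith)⟩

/-- If the flux at the clamped end or the displacement at the free end vanishes, then so does the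
whole solution. -/
theorem eq_zero_of (hν : 0 ≤ ν) (h : IsPairSol r₁ r₂ M ν y₁ p₁ y₂ p₂)
    (h0 : p₁ 0 = 0 ∨ y₂ 0 = 0) :
    (∀ t ∈ Icc (0 : ℝ) 1, y₁ t = 0) ∧ ∀ t ∈ Icc (0 : ℝ) 1, y₂ t = 0 := by
  have m1 : (1 : ℝ) ∈ Icc (0 : ℝ) 1 := by simp
  have hm := h.mass
  have hc := h.continuity
  rcases h0 with h0 | h0
  · have z := h.left.eq_zero_of_left hν h.dirichlet h0
    obtain ⟨z1, z2⟩ := z 1 m1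
    rw [z1] at hc
    rw [z1, z2, mul_zero, zero_add] at hm
    have z' := h.right.eq_zero_of_right hν hc.symm hm
    exact ⟨fun t ht => (z t ht).1, fun t ht => (z' t ht).1⟩
  · have z := h.right.eq_zero_of_left hν h0 h.neumann
    obtain ⟨z1, z2⟩ := z 1 m1
    rw [z1] at hc
    rw [hc, z2, mul_zero, add_zero] at hm
    have z' := h.left.eq_zero_of_right hν hc hm
    exact ⟨fun t ht => (z' t ht).1, fun t ht => (z t ht).1⟩

/-- Pair solutions with the same parameter are proportional. -/
theorem exists_eq_mul {z₁ w₁ z₂ w₂ : ℝ → ℝ} (hν : 0 ≤ ν)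
    (h : IsPairSol r₁ r₂ M ν y₁ p₁ y₂ p₂)
    (hne : ¬ ((∀ t ∈ Icc (0 : ℝ) 1, y₁ t = 0) ∧ ∀ t ∈ Icc (0 : ℝ) 1, y₂ t = 0))
    (h' : IsPairSol r₁ r₂ M ν z₁ w₁ z₂ w₂) :
    ∃ k : ℝ, (∀ t ∈ Icc (0 : ℝ) 1, z₁ t = k * y₁ t) ∧ ∀ t ∈ Icc (0 : ℝ) 1, z₂ t = k * y₂ t := by
  have hp : p₁ 0 ≠ 0 := fun h0 => hne (h.eq_zero_of hν (Or.inl h0))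
  obtain ⟨e1, e2⟩ := (h'.sub_smul h (w₁ 0 / p₁ 0)).eq_zero_of hν
    (Or.inl (by field_simp; ring))
  exact ⟨w₁ 0 / p₁ 0, fun t ht => sub_eq_zero.1 (e1 t ht), fun t ht => sub_eq_zero.1 (e2 t ht)⟩

end IsPairSol

/-- For an eigenvalue, the solutions `y₁`, `y₂` normalized by unit Cauchy data at the outer ends
satisfy the characteristic equation `p₁ y₂ + p₂ y₁ = ν M y₁ y₂` at the joint. -/
theorem IsPairEigenvalue.exists_normalized {r₁ r₂ : Rod} {M ν : ℝ} (hν : 0 ≤ ν)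
    (h : IsPairEigenvalue r₁ r₂ M ν) :
    ∃ y₁ p₁ y₂ p₂ : ℝ → ℝ, r₁.IsSol ν y₁ p₁ ∧ r₂.IsSol ν y₂ p₂ ∧ y₁ 0 = 0 ∧ p₁ 0 = 1 ∧
      y₂ 0 = 1 ∧ p₂ 0 = 0 ∧ p₁ 1 * y₂ 1 + p₂ 1 * y₁ 1 = ν * M * y₁ 1 * y₂ 1 := by
  obtain ⟨y₁, p₁, y₂, p₂, hs, hne⟩ := h
  have hp : p₁ 0 ≠ 0 := fun h0 => hne (hs.eq_zero_of hν (Or.inl h0))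
  have hy : y₂ 0 ≠ 0 := fun h0 => hne (hs.eq_zero_of hν (Or.inr h0))
  refine ⟨_, _, _, _, hs.left.smul (p₁ 0)⁻¹, hs.right.smul (y₂ 0)⁻¹, by simp [hs.dirichlet],
    by simp [hp], by simp [hy], by simp [hs.neumann], ?_⟩
  have hm := hs.mass
  rw [hs.continuity] at hm ⊢
  linear_combination (p₁ 0)⁻¹ * (y₂ 0)⁻¹ * y₂ 1 * hm

/-- The eigenvalues of a pair of rods are uniformly separated. -/
theorem exists_gap (r₁ r₂ : Rod) {M : ℝ} (hM : 0 < M) : ∃ δ : ℝ, 0 < δ ∧ ∀ ν μ : ℝ,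
    IsPairEigenvalue r₁ r₂ M ν → IsPairEigenvalue r₁ r₂ M μ → ν < μ → δ ≤ μ - ν := by
  set η := min (1 / 8) (1 / (8 * M)) with hη
  have hη0 : 0 < η := lt_min (by norm_num) (by positivity)
  have hη8 : η ≤ 1 / 8 := min_le_left _ _
  have hηM : 8 * M * η ≤ 1 := by
    have h1 : η ≤ 1 / (8 * M) := min_le_right _ _
    rw [le_div_iff₀ (by positivity)] at h1
    linarith
  have hC₁ := r₁.compConst_pos
  have hC₂ := r₂.compConst_pos
  set C := r₁.compConst + r₂.compConst with hC
  have hC0 : 0 < C := by positivity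
  refine ⟨min 1 (η / (C + 1)), lt_min one_pos (by positivity), fun ν μ hν hμ hνμ => ?_⟩
  by_contra! hlt
  have pos : ∀ {ν}, IsPairEigenvalue r₁ r₂ M ν → 0 < ν := by
    rintro ν ⟨_, _, _, _, hs, hne⟩
    exact hs.pos_of_ne_zero hM hne
  have hν0 := pos hν
  have hμ0 := pos hμ
  have hd0 : 0 < μ - ν := sub_pos.2 hνμ
  have hd1 : μ - ν < 1 := hlt.trans_le (min_le_left _ _)
  have hd2 : (μ - ν) * (C + 1) ≤ η := by
    have := (hlt.trans_le (min_le_right _ _)).le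
    rwa [le_div_iff₀ (by positivity)] at this
  have hCη : C * (μ - ν) ^ 2 ≤ η ^ 2 := by
    have h1 : ((μ - ν) * (C + 1)) ^ 2 ≤ η ^ 2 := by gcongr
    have h2 : 0 ≤ (μ - ν) ^ 2 * (C ^ 2 + C + 1) := by positivity
    linarith
  have hη1 : η ^ 2 ≤ 1 := by
    rw [sq_le_one_iff₀ hη0.le]; linarith
  have hCle : ∀ r : Rod, r.compConst ≤ C → r.compConst * (μ - ν) ^ 2 ≤ η ^ 2 := fun r hr =>
    (mul_le_mul_of_nonneg_right hr (sq_nonneg _)).trans hCη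
  have hclose : ∀ r : Rod, r.compConst ≤ C → ∀ y p y' p' : ℝ → ℝ, r.IsSol ν y p →
      r.IsSol μ y' p' → y' 0 = y 0 → p' 0 = p 0 → (∃ t ∈ Icc (0 : ℝ) 1, y' t ≠ 0) →
      CloseData (1 + ν) (1 + μ) η (y 1) (p 1) (y' 1) (p' 1) := by
    intro r hr y p y' p' h h' hy hp hne
    obtain ⟨c1, c2⟩ := Rod.comparison hν0.le hνμ ((hCle r hr).trans hη1) h h' hy hp hne
    refine ⟨c1.trans (mul_le_mul_of_nonneg_right (hCle r hr) ?_), c2⟩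
    have : 0 < 1 + μ := by linarith
    positivity
  obtain ⟨y₁, p₁, y₂, p₂, s1, s2, i1, i2, i3, i4, e⟩ := hν.exists_normalized hν0.le
  obtain ⟨y₁', p₁', y₂', p₂', s1', s2', i1', i2', i3', i4', e'⟩ := hμ.exists_normalized hμ0.le
  have k1 := hclose r₁ (by linarith) y₁ p₁ y₁' p₁' s1 s1' (by rw [i1, i1']) (by rw [i2, i2']) (by
    by_contra! h0
    have := s1'.flux_eq_zero zero_lt_one Rod.σ_ne_zero h0 0 (by simp)
    rw [i2'] at this
    exact one_ne_zero this)
  have k2 := hclose r₂ (by linarith) y₂ p₂ y₂' p₂' s2 s2' (by rw [i3, i3']) (by rw [i4, i4'])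
    ⟨0, by simp, by rw [i3']; exact one_ne_zero⟩
  exact k1.false_of_characteristic k2 hM (by linarith) (by linarith) (by linarith) hη0 hη8 hηM
    (by linear_combination e) (by linear_combination e')

/-- The eigenvalues of a pair of rods are unbounded: in polar coordinates the characteristic
equation reads `sin (Θ₁ + Θ₂) = s M sin Θ₁ sin Θ₂`, and when `Θ₁ + Θ₂` passes through consecutive
multiples of `π`, the difference of the two sides takes opposite signs. -/
theorem exists_pairEigenvalue_gt (r₁ r₂ : Rod) {M : ℝ} (hM : 0 < M) (K : ℝ) :
    ∃ ν, K < ν ∧ IsPairEigenvalue r₁ r₂ M ν := by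
  obtain ⟨Θ₁, c1, t1, h1⟩ := r₁.exists_polar 0
  obtain ⟨Θ₂, c2, t2, h2⟩ := r₂.exists_polar (Real.pi / 2)
  set A := |K| + 1 with hA
  have hA1 : 1 ≤ A := by rw [hA]; linarith [abs_nonneg K]
  have hsub : Ici A ⊆ Ioi (0 : ℝ) := fun x hx => by
    have : A ≤ x := hx
    exact mem_Ioi.2 (by linarith)
  have cΘ : ContinuousOn (fun s => Θ₁ s + Θ₂ s) (Ici A) := (c1.mono hsub).add (c2.mono hsub)
  have himg := isPreconnected_Ici.intermediate_value_Ici (s := Ici A) (a := A) (l := atTop)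
    self_mem_Ici (le_principal_iff.2 (Ici_mem_atTop A)) cΘ (t1.atTop_add_atTop t2)
  obtain ⟨n, hn⟩ := exists_nat_ge ((Θ₁ A + Θ₂ A) / (2 * Real.pi))
  rw [div_le_iff₀ (by positivity)] at hn
  obtain ⟨s₁, hs₁, e₁⟩ := himg (show (n : ℝ) * (2 * Real.pi) ∈ Ici (Θ₁ A + Θ₂ A) from hn)
  obtain ⟨s₂, hs₂, e₂⟩ := himg (show (n : ℝ) * (2 * Real.pi) + Real.pi ∈ Ici (Θ₁ A + Θ₂ A) from
    hn.trans (by linarith [Real.pi_pos]))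
  simp only at e₁ e₂
  set χ : ℝ → ℝ := fun s =>
    Real.sin (Θ₁ s + Θ₂ s) - s * M * Real.sin (Θ₁ s) * Real.sin (Θ₂ s) with hχ
  have cχ : ContinuousOn χ (Ici A) :=
    (Real.continuous_sin.comp_continuousOn cΘ).sub
      (((continuousOn_id.mul continuousOn_const).mul
        (Real.continuous_sin.comp_continuousOn (c1.mono hsub))).mul
        (Real.continuous_sin.comp_continuousOn (c2.mono hsub)))
  have hχ₁ : 0 ≤ χ s₁ := by
    have h3 : Real.sin (Θ₂ s₁) = -Real.sin (Θ₁ s₁) := by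
      rw [show Θ₂ s₁ = (n : ℝ) * (2 * Real.pi) - Θ₁ s₁ by linarith, Real.sin_nat_mul_two_pi_sub]
    have h4 : Real.sin (Θ₁ s₁ + Θ₂ s₁) = 0 := by
      rw [e₁]
      have := Real.sin_nat_mul_pi (n * 2)
      rw [← this]; push_cast; ring_nf
    have h5 : 0 ≤ s₁ * M * Real.sin (Θ₁ s₁) ^ 2 := by
      have : (0 : ℝ) < s₁ := hsub hs₁
      positivity
    simp only [hχ, h3, h4]
    linarith
  have hχ₂ : χ s₂ ≤ 0 := by
    have h3 : Real.sin (Θ₂ s₂) = Real.sin (Θ₁ s₂) := by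
      rw [show Θ₂ s₂ = (n : ℝ) * (2 * Real.pi) - (Θ₁ s₂ - Real.pi) by linarith,
        Real.sin_nat_mul_two_pi_sub, Real.sin_sub_pi, neg_neg]
    have h4 : Real.sin (Θ₁ s₂ + Θ₂ s₂) = 0 := by
      rw [e₂]
      have := Real.sin_nat_mul_pi (n * 2 + 1)
      rw [← this]; push_cast; ring_nf
    have h5 : 0 ≤ s₂ * M * Real.sin (Θ₁ s₂) ^ 2 := by
      have : (0 : ℝ) < s₂ := hsub hs₂
      positivity
    simp only [hχ, h3, h4]
    linarith
  obtain ⟨s, hsA, hs0⟩ := isPreconnected_Ici.intermediate_value hs₂ hs₁ cχ ⟨hχ₂, hχ₁⟩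
  have hs : 0 < s := hsub hsA
  have hsA' : A ≤ s := hsA
  refine ⟨s ^ 2, ?_, ?_⟩
  · have : s ≤ s ^ 2 := by
      rw [sq]; exact le_mul_of_one_le_left hs.le (by linarith)
    linarith [le_abs_self K]
  obtain ⟨y₁, p₁, R₁, hR₁, sol₁, i1, i2, a1, b1⟩ := h1 s hs
  obtain ⟨y₂, p₂, R₂, hR₂, sol₂, i3, i4, a2, b2⟩ := h2 s hs
  rw [Real.sin_zero, zero_div] at i1
  rw [Real.sin_pi_div_two] at i3
  rw [Real.cos_pi_div_two] at i4
  have hchar : p₁ 1 * y₂ 1 + p₂ 1 * y₁ 1 = s ^ 2 * M * y₁ 1 * y₂ 1 := by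
    have h3 : Real.sin (Θ₁ s + Θ₂ s) = s * M * Real.sin (Θ₁ s) * Real.sin (Θ₂ s) :=
      sub_eq_zero.1 hs0
    rw [Real.sin_add] at h3
    rw [a1, b1, a2, b2]
    field_simp
    linear_combination h3
  have hne : ∀ {α β : ℝ}, β ≠ 0 → ¬ ((∀ t ∈ Icc (0 : ℝ) 1, α * y₁ t = 0) ∧
      ∀ t ∈ Icc (0 : ℝ) 1, β * y₂ t = 0) := by
    rintro α β hβ ⟨-, h0⟩
    have := h0 0 (by simp)
    rw [i3] at this
    exact mul_ne_zero hβ (one_div_ne_zero hs.ne') this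
  by_cases ha : y₁ 1 = 0
  · -- both rods have a node at the joint, and the two fluxes can be balanced
    have hp : p₁ 1 ≠ 0 := by
      intro hp
      rw [a1, div_eq_zero_iff, or_iff_left hs.ne', mul_eq_zero, or_iff_right hR₁.ne'] at ha
      rw [b1, mul_eq_zero, or_iff_right hR₁.ne'] at hp
      have := Real.sin_sq_add_cos_sq (Θ₁ s)
      rw [ha, hp] at this
      norm_num at this
    have hb : y₂ 1 = 0 := by
      rw [ha] at hchar
      simpa [hp] using hchar
    exact ⟨_, _, _, _, ⟨sol₁.smul (p₂ 1), sol₂.smul (-p₁ 1), by simp [i1], by simp [i4],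
      by simp [ha, hb], by simp only [ha]; ring⟩, hne (neg_ne_zero.2 hp)⟩
  · exact ⟨_, _, _, _, ⟨sol₁.smul (y₂ 1), sol₂.smul (y₁ 1), by simp [i1], by simp [i4],
      by ring, by linear_combination hchar⟩, hne ha⟩

/-! ### Enumeration of separated sets -/

/-- An unbounded set of positive reals whose elements are uniformly separated is the range of a
strictly increasing sequence. -/
theorem exists_strictMono_range_eq {s : Set ℝ} {δ : ℝ} (hδ : 0 < δ) (hpos : ∀ x ∈ s, 0 < x)
    (hgap : ∀ x ∈ s, ∀ y ∈ s, x < y → δ ≤ y - x) (hunb : ∀ K, ∃ x ∈ s, K < x) :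
    ∃ ν : ℕ → ℝ, StrictMono ν ∧ Set.range ν = s ∧ Tendsto ν atTop atTop := by
  have hfl : ∀ x ∈ s, ∀ y ∈ s, x < y → ⌊x / δ⌋₊ < ⌊y / δ⌋₊ := by
    intro x hx y hy hxy
    have h1 : x / δ + 1 ≤ y / δ := by
      rw [div_add_one hδ.ne']
      exact div_le_div_of_nonneg_right (by linarith [hgap x hx y hy hxy]) hδ.le
    have h2 := Nat.floor_le_floor h1
    rw [Nat.floor_add_one (div_pos (hpos x hx) hδ).le] at h2
    omega
  set P : ℕ → Prop := fun n => ∃ x ∈ s, ⌊x / δ⌋₊ = n with hP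
  have hinf : (Set.ofPred P).Infinite := by
    rw [Set.infinite_iff_exists_gt]
    intro n
    obtain ⟨x, hx, hnx⟩ := hunb ((n + 1 : ℕ) * δ)
    refine ⟨⌊x / δ⌋₊, ⟨x, hx, rfl⟩, ?_⟩
    have h1 : ((n + 1 : ℕ) : ℝ) ≤ x / δ := by rw [le_div_iff₀ hδ]; exact hnx.le
    exact Nat.le_floor h1
  have hmem : ∀ n, P (Nat.nth P n) := fun n => Nat.nth_mem_of_infinite hinf n
  choose ν hν hνf using hmem
  have hmono : StrictMono ν := by
    intro m n hmn
    have h1 : Nat.nth P m < Nat.nth P n := Nat.nth_strictMono hinf hmn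
    by_contra! h2
    rcases h2.lt_or_eq with h3 | h3
    · have := hfl _ (hν n) _ (hν m) h3
      rw [hνf, hνf] at this
      omega
    · have h4 := hνf m
      rw [← h3, hνf n] at h4
      omega
  have hrange : Set.range ν = s := by
    refine Set.Subset.antisymm (Set.range_subset_iff.2 hν) fun x hx => ?_
    obtain ⟨n, hn⟩ : ⌊x / δ⌋₊ ∈ Set.range (Nat.nth P) := by
      rw [Nat.range_nth_of_infinite hinf]
      exact ⟨x, hx, rfl⟩
    refine ⟨n, ?_⟩
    rcases lt_trichotomy (ν n) x with h | h | h
    · have := hfl _ (hν n) _ hx h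
      rw [hνf] at this
      omega
    · exact h
    · have := hfl _ hx _ (hν n) h
      rw [hνf] at this
      omega
  refine ⟨ν, hmono, hrange, tendsto_atTop_atTop_of_monotone hmono.monotone fun K => ?_⟩
  obtain ⟨x, hx, hKx⟩ := hunb K
  rw [← hrange] at hx
  obtain ⟨n, rfl⟩ := hx
  exact ⟨n, hKx.le⟩

/-! ### The spectral problem -/

namespace PointMassSystem

/-- The spectral problem as a problem for two rods on `[0, 1]`, by means of `x = t - 1` on the left
and of `x = 1 - t` on the right. -/
theorem exists_pair (S : PointMassSystem) : ∃ r₁ r₂ : Rod, ∀ ν : ℝ,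
    (∀ u v : ℝ → ℝ, S.IsNeumannSolution ν u v → ∃ p₁ p₂ : ℝ → ℝ,
      IsPairSol r₁ r₂ S.M ν (fun t => u (1 * t + -1)) p₁ (fun t => v (-1 * t + 1)) p₂) ∧
    ∀ y₁ p₁ y₂ p₂ : ℝ → ℝ, IsPairSol r₁ r₂ S.M ν y₁ p₁ y₂ p₂ →
      S.IsNeumannSolution ν (fun x => y₁ (1 * x + -(1 * -1)))
        (fun x => y₂ (-1 * x + -(-1 * 1))) := by
  have g1 : MapsTo (fun t : ℝ => 1 * t + -1) (Icc 0 1) (Icc (-1) 0) := fun t ht =>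
    ⟨by linarith [ht.1], by linarith [ht.2]⟩
  have g2 : MapsTo (fun t : ℝ => -1 * t + 1) (Icc 0 1) (Icc 0 1) := fun t ht =>
    ⟨by linarith [ht.2], by linarith [ht.1]⟩
  have g1' : MapsTo (fun x : ℝ => 1 * x + -(1 * -1)) (Icc (-1) 0) (Icc 0 1) := fun t ht =>
    ⟨by linarith [ht.1], by linarith [ht.2]⟩
  have g2' : MapsTo (fun x : ℝ => -1 * x + -(-1 * 1)) (Icc 0 1) (Icc 0 1) := fun t ht =>
    ⟨by linarith [ht.2], by linarith [ht.1]⟩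
  have hab1 : (-1 : ℝ) < 0 := by norm_num
  have hab2 : (0 : ℝ) < 1 := by norm_num
  have he1 : (1 : ℝ) * 1 = 1 := by norm_num
  have he2 : (-1 : ℝ) * -1 = 1 := by norm_num
  obtain ⟨r₁, ρ1, σ1, q1⟩ := exists_rod hab1.le he1 g1 S.ρ₁_mem S.σ₁_mem S.q₁_cont S.ρ₁_pos
    S.σ₁_pos S.q₁_pos
  obtain ⟨r₂, ρ2, σ2, q2⟩ := exists_rod hab2.le he2 g2 S.ρ₂_mem S.σ₂_mem S.q₂_cont S.ρ₂_pos
    S.σ₂_pos S.q₂_pos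
  have m0 : (0 : ℝ) ∈ Icc (0 : ℝ) 1 := by simp
  have m1 : (1 : ℝ) ∈ Icc (0 : ℝ) 1 := by simp
  refine ⟨r₁, r₂, fun ν => ⟨fun u v h => ?_, fun y₁ p₁ y₂ p₂ h => ?_⟩⟩
  · obtain ⟨p₁, s1, f1⟩ := h.left_eq.exists_isSol hab1 he1 g1 S.ρ₁_mem S.σ₁_mem S.q₁_cont
      S.σ₁_pos ρ1 σ1 q1
    obtain ⟨p₂, s2, f2⟩ := h.right_eq.exists_isSol hab2 he2 g2 S.ρ₂_mem S.σ₂_mem S.q₂_cont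
      S.σ₂_pos ρ2 σ2 q2
    refine ⟨p₁, p₂, s1, s2, ?_, ?_, ?_, ?_⟩
    · simpa using h.dirichlet
    · rw [f2 0 m0]
      simp [h.neumann]
    · simpa using h.continuity
    · rw [f1 1 m1, f2 1 m1]
      have := h.mass
      norm_num
      linarith
  · obtain ⟨s1, f1⟩ := h.left.solvesSturmLiouville hab1 he1 g1' S.ρ₁_mem S.σ₁_mem S.q₁_cont
      S.σ₁_pos ρ1 σ1 q1
    obtain ⟨s2, f2⟩ := h.right.solvesSturmLiouville hab2 he2 g2' S.ρ₂_mem S.σ₂_mem S.q₂_cont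
      S.σ₂_pos ρ2 σ2 q2
    refine ⟨s1, s2, ?_, ?_, ?_, ?_⟩
    · simpa using h.dirichlet
    · have h1 := f2 1 m1
      rw [show (-1 * 1 + -(-1 * 1) : ℝ) = 0 by norm_num, h.neumann, mul_zero, mul_eq_zero] at h1
      exact h1.resolve_left (S.σ₂_pos.ne_zero 1 m1)
    · simpa using h.continuity
    · rw [f1 0 (by norm_num), f2 0 m0]
      have := h.mass
      norm_num
      linarith

end PointMassSystem

/-- The eigenvalues form a sequence `0 < ν 0 < ν 1 < ⋯ → ∞` of simple eigenvalues (numbered here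
from `0`), and the gaps between consecutive ones have a positive lower bound. -/
theorem theorem5p1 (S : PointMassSystem) :
    ∃ ν : ℕ → ℝ,
      (StrictMono ν ∧ Set.range ν = S.neumannEigenvalues ∧ 0 < ν 0 ∧
        Tendsto ν atTop atTop ∧ ∀ n, S.IsSimpleNeumannEigenvalue (ν n)) ∧
      ∃ δ₂ : ℝ, 0 < δ₂ ∧ ∀ n, δ₂ ≤ ν (n + 1) - ν n := by
  obtain ⟨r₁, r₂, hpair⟩ := S.exists_pair
  -- a pair of functions vanishes on `[-1, 0]` and `[0, 1]` iff its pullback vanishes on `[0, 1]`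
  have pull : ∀ {u w : ℝ → ℝ} (k : ℝ),
      (∀ t ∈ Icc (0 : ℝ) 1, u (1 * t + -1) = k * w (1 * t + -1)) →
      ∀ x ∈ Icc (-1 : ℝ) 0, u x = k * w x := by
    intro u w k h x hx
    have := h (x + 1) ⟨by linarith [hx.1], by linarith [hx.2]⟩
    simpa using this
  have pull' : ∀ {u w : ℝ → ℝ} (k : ℝ),
      (∀ t ∈ Icc (0 : ℝ) 1, u (-1 * t + 1) = k * w (-1 * t + 1)) →
      ∀ x ∈ Icc (0 : ℝ) 1, u x = k * w x := by
    intro u w k h x hx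
    have := h (1 - x) ⟨by linarith [hx.2], by linarith [hx.1]⟩
    simpa using this
  have fwd : ∀ {ν : ℝ} {u v : ℝ → ℝ}, S.IsNeumannEigenfunction ν u v → ∃ p₁ p₂ : ℝ → ℝ,
      IsPairSol r₁ r₂ S.M ν (fun t => u (1 * t + -1)) p₁ (fun t => v (-1 * t + 1)) p₂ ∧
      ¬ ((∀ t ∈ Icc (0 : ℝ) 1, u (1 * t + -1) = 0) ∧
        ∀ t ∈ Icc (0 : ℝ) 1, v (-1 * t + 1) = 0) := by
    rintro ν u v ⟨hs, hne⟩
    obtain ⟨p₁, p₂, h⟩ := (hpair ν).1 u v hs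
    refine ⟨p₁, p₂, h, fun h0 => hne ⟨?_, ?_⟩⟩
    · simpa using pull (w := 0) 0 (by simpa using h0.1)
    · simpa using pull' (w := 0) 0 (by simpa using h0.2)
  have hiff : ∀ ν, ν ∈ S.neumannEigenvalues ↔ IsPairEigenvalue r₁ r₂ S.M ν := by
    intro ν
    constructor
    · rintro ⟨u, v, h⟩
      obtain ⟨p₁, p₂, h1, h2⟩ := fwd h
      exact ⟨_, _, _, _, h1, h2⟩
    · rintro ⟨y₁, p₁, y₂, p₂, hs, hne⟩
      refine ⟨_, _, (hpair ν).2 _ _ _ _ hs, fun h0 => hne ⟨fun t ht => ?_, fun t ht => ?_⟩⟩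
      · have := h0.1 (t - 1) ⟨by linarith [ht.1], by linarith [ht.2]⟩
        simpa using this
      · have := h0.2 (1 - t) ⟨by linarith [ht.2], by linarith [ht.1]⟩
        simpa using this
  have hpos : ∀ ν ∈ S.neumannEigenvalues, 0 < ν := by
    rintro ν ⟨u, v, h⟩
    obtain ⟨p₁, p₂, h1, h2⟩ := fwd h
    exact h1.pos_of_ne_zero S.M_pos h2
  obtain ⟨δ, hδ, hgap⟩ := exists_gap r₁ r₂ S.M_pos
  obtain ⟨ν, hmono, hrange, hlim⟩ := exists_strictMono_range_eq hδ hpos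
    (fun x hx y hy => hgap x y ((hiff x).1 hx) ((hiff y).1 hy))
    (fun K => by
      obtain ⟨x, hK, hx⟩ := exists_pairEigenvalue_gt r₁ r₂ S.M_pos K
      exact ⟨x, (hiff x).2 hx, hK⟩)
  have hmem : ∀ n, ν n ∈ S.neumannEigenvalues := fun n => hrange ▸ mem_range_self n
  refine ⟨ν, ⟨hmono, hrange, hpos _ (hmem 0), hlim, fun n => ?_⟩, δ, hδ, fun n =>
    hgap _ _ ((hiff _).1 (hmem n)) ((hiff _).1 (hmem (n + 1))) (hmono n.lt_succ_self)⟩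
  obtain ⟨u, v, h⟩ := hmem n
  obtain ⟨p₁, p₂, h1, h2⟩ := fwd h
  refine ⟨u, v, h, fun u' v' h' => ?_⟩
  obtain ⟨w₁, w₂, h3⟩ := (hpair _).1 u' v' h'
  obtain ⟨k, k1, k2⟩ := h1.exists_eq_mul (hpos _ (hmem n)).le h2 h3
  exact ⟨k, pull k k1, pull' k k2⟩
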